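/- Let $\mathbf{sMlt}$ be the category of (small) symmetric multicategories (coloured operads) and symmetric functors, and $\mathbf{Cat}$ the category of small categories and functors. For a category $\mathcal C$ let $\mathcal C_\blacktriangleright$ be the symmetric multicategory with the objects of $\mathcal C$, with $\mathcal C_\blacktriangleright(X_1,\dots,X_n;X)=\mathcal C(X_1,X)\times\cdots\times\mathcal C(X_n,X)$, with composition $\langle f_i\rangle_i(\langle g_{ij}\rangle_j)_i=\langle f_i g_{ij}\rangle_{i,j}$ and permutations permuting the entries; this gives a functor $(-)_\blacktriangleright:\mathbf{Cat}\to\mathbf{sMlt}$. Call a symmetric multicategory sequential if it is isomorphic to some $\mathcal C_\blacktriangleright$, and let $\mathbf{Seq}\subseteq\mathbf{sMlt}$ be the full subcategory of sequential ones. Let $1_\blacktriangleright$ be the image of the terminal category, $\star$ its object, and $\mathcal M_-$ the category of objects and unary arrows of $\mathcal M$. Let $\mathcal M\otimes\mathcal N$ be the Boardman–Vogt tensor product: its objects are pairs $\langle A,X\rangle$, and its arrows are generated by arrows $f_X$ ($f$ in $\mathcal M$, $X\in\mathcal N$) and $h_A$ ($h$ in $\mathcal N$, $A\in\mathcal M$)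 subject to functoriality of $(-)_X$ and of $(-)_A$ and to $f_X(h_{A_1},\dots,h_{A_n})=\sigma\, h_A(f_{X_1},\dots,f_{X_m})$ for $f:A_1,\dots,A_n\to A$ and $h:X_1,\dots,X_m\to X$, where $\sigma$ is the transposition of rows and columns. Let $[\mathcal M,\mathcal N]$ be the symmetric multicategory whose objects are the functors $\mathcal M\to\mathcal N$ and whose arrows $F_1,\dots,F_n\to F$ are the families $\alpha_A:F_1A,\dots,F_nA\to FA$ ($A\in\mathcal M$) with $Ff(\alpha_{A_1},\dots,\alpha_{A_m})=\sigma\,\alpha_A(F_1f,\dots,F_nf)$ for every $f:A_1,\dots,A_m\to A$ in $\mathcal M$, with pointwise structure. Let $\mathrm{cMon}(\mathcal M)$ be the category of commutative monoids in $\mathcal M$ (an object $X$ with arrows $X,X\to X$ and $(\,)\to X$ satisfying associativity, the unit laws and commutativity; morphisms are the unary arrows compatible with these). Then: 1. $1_\blacktriangleright\otimes\mathcal M$ is sequential for every $\mathcal M\in\mathbf{sMlt}$, and $1_\blacktriangleright\otimes-:\mathbf{sMlt}\to\mathbf{Seq}$ is left adjoint to the inclusion $\mathbf{Seq}\subseteq\mathbf{sMlt}$,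 with unit the canonical functor $\mathcal M\to 1_\blacktriangleright\otimes\mathcal M$, $f\mapsto f_\star$. That is, $1_\blacktriangleright\otimes-$ is a reflection of $\mathbf{sMlt}$ in $\mathbf{Seq}$. 2. $[1_\blacktriangleright,\mathcal M]$ is sequential for every $\mathcal M\in\mathbf{sMlt}$, and $[1_\blacktriangleright,-]:\mathbf{sMlt}\to\mathbf{Seq}$ is right adjoint to the inclusion $\mathbf{Seq}\subseteq\mathbf{sMlt}$, with counit the canonical functor $[1_\blacktriangleright,\mathcal M]\to\mathcal M$, evaluation at $\star$. That is, $[1_\blacktriangleright,-]$ is a coreflection of $\mathbf{sMlt}$ in $\mathbf{Seq}$. 3. The functor $(-)_\blacktriangleright:\mathbf{Cat}\to\mathbf{sMlt}$ has both a left and a right adjoint: $$(1_\blacktriangleright\otimes-)_-\;\dashv\;(-)_\blacktriangleright\;\dashv\;[1_\blacktriangleright,-]_-\;\cong\;\mathrm{cMon}(-),$$ where the isomorphism is natural; in particular $\mathrm{cMon}(-)$ is right adjoint to $(-)_\blacktriangleright$. -/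

import Mathlib

open CategoryTheory

universe w u

/-! ### Canonical bijections between index sets -/

/-- `Σ _ : 1, ι ≃ ι`. -/
def unitSigma (ι : Type) : (Σ _ : Unit, ι) ≃ ι where
  toFun p := p.2
  invFun i := ⟨(), i⟩

/-- `Σ _ : ι, 1 ≃ ι`. -/
def sigmaUnit (ι : Type) : (Σ _ : ι, Unit) ≃ ι where
  toFun p := p.1
  invFun i := ⟨i, ()⟩

/-- The "obvious permutation" exchanging rows and columns of a rectangular array. -/
def sigmaSwap (ι κ : Type) : (Σ _ : ι, κ) ≃ (Σ _ : κ, ι) where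
  toFun p := ⟨p.2, p.1⟩
  invFun p := ⟨p.2, p.1⟩

instance finiteBif (ι κ : Type) [Finite ι] [Finite κ] (b : Bool) :
    Finite (bif b then κ else ι) := by
  cases b <;> assumption

/-! ### Symmetric multicategories -/

/-- A symmetric multicategory (coloured operad). The domain of an arrow is a finite family of
objects; following a standard convention, the families are indexed by arbitrary finite sets `ι`
rather than only by the sets `{1, …, n}` (an `n`-ary arrow `A₁, …, Aₙ → B` is an element of
`Hom A B` for `A : Fin n → Obj`), and bijections of index sets act on arrows. Composition
substitutes an arrow into every place of the domain of an arrow. -/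
structure SymMulticat : Type (w + 1) where
  /-- objects -/
  Obj : Type w
  /-- arrows `(A i)_{i ∈ ι} → B` -/
  Hom : {ι : Type} → [Finite ι] → (ι → Obj) → Obj → Type w
  /-- unary identity arrows -/
  id : (A : Obj) → Hom (fun _ : Unit => A) A
  /-- `f(g₁, …, gₙ)` -/
  comp : {ι : Type} → [Finite ι] → {κ : ι → Type} → [∀ i, Finite (κ i)] →
    {A : ι → Obj} → {B : Obj} → {X : (i : ι) → κ i → Obj} →
    Hom A B → ((i : ι) → Hom (X i) (A i)) → Hom (fun p : Σ i, κ i => X p.1 p.2) B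
  /-- the action of bijections of index sets -/
  reindex : {ι κ : Type} → [Finite ι] → [Finite κ] → {A : ι → Obj} → {B : Obj} →
    (σ : κ ≃ ι) → Hom A B → Hom (fun k => A (σ k)) B
  id_comp : ∀ {ι : Type} [Finite ι] {A : ι → Obj} {B : Obj} (f : Hom A B),
    comp (id B) (fun _ : Unit => f) = reindex (unitSigma ι) f
  comp_id : ∀ {ι : Type} [Finite ι] {A : ι → Obj} {B : Obj} (f : Hom A B),
    comp f (fun i => id (A i)) = reindex (sigmaUnit ι) f
  assoc : ∀ {ι : Type} [Finite ι] {κ : ι → Type} [∀ i, Finite (κ i)]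
    {l : (i : ι) → κ i → Type} [∀ i k, Finite (l i k)]
    {A : ι → Obj} {B : Obj} {X : (i : ι) → κ i → Obj}
    {Y : (i : ι) → (k : κ i) → l i k → Obj}
    (f : Hom A B) (g : (i : ι) → Hom (X i) (A i))
    (h : (i : ι) → (k : κ i) → Hom (Y i k) (X i k)),
    comp (comp f g) (fun p : Σ i, κ i => h p.1 p.2) =
      reindex (Equiv.sigmaAssoc l) (comp f (fun i => comp (g i) (h i)))
  reindex_refl : ∀ {ι : Type} [Finite ι] {A : ι → Obj} {B : Obj} (f : Hom A B),
    reindex (Equiv.refl ι) f = f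
  reindex_trans : ∀ {ι κ l : Type} [Finite ι] [Finite κ] [Finite l] {A : ι → Obj} {B : Obj}
    (σ : κ ≃ ι) (τ : l ≃ κ) (f : Hom A B),
    reindex τ (reindex σ f) = reindex (τ.trans σ) f
  comp_reindex_right : ∀ {ι : Type} [Finite ι] {κ l : ι → Type} [∀ i, Finite (κ i)]
    [∀ i, Finite (l i)] {A : ι → Obj} {B : Obj} {X : (i : ι) → κ i → Obj}
    (f : Hom A B) (g : (i : ι) → Hom (X i) (A i)) (σ : (i : ι) → l i ≃ κ i),
    comp f (fun i => reindex (σ i) (g i)) = reindex (Equiv.sigmaCongrRight σ) (comp f g)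
  comp_reindex_left : ∀ {ι ι' : Type} [Finite ι] [Finite ι'] {κ : ι → Type} [∀ i, Finite (κ i)]
    {A : ι → Obj} {B : Obj} {X : (i : ι) → κ i → Obj}
    (f : Hom A B) (g : (i : ι) → Hom (X i) (A i)) (σ : ι' ≃ ι),
    comp (reindex σ f) (fun i => g (σ i)) =
      reindex (Equiv.sigmaCongrLeft (β := κ) σ) (comp f g)

/-- A functor of symmetric multicategories. -/
@[ext]
structure MFunctor (M N : SymMulticat.{w}) : Type (max 1 w) where
  obj : M.Obj → N.Obj
  map : {ι : Type} → [Finite ι] → {A : ι → M.Obj} → {B : M.Obj} →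
    M.Hom A B → N.Hom (fun i => obj (A i)) (obj B)
  map_id : ∀ A : M.Obj, map (M.id A) = N.id (obj A)
  map_comp : ∀ {ι : Type} [Finite ι] {κ : ι → Type} [∀ i, Finite (κ i)]
    {A : ι → M.Obj} {B : M.Obj} {X : (i : ι) → κ i → M.Obj}
    (f : M.Hom A B) (g : (i : ι) → M.Hom (X i) (A i)),
    map (M.comp f g) = N.comp (map f) (fun i => map (g i))
  map_reindex : ∀ {ι κ : Type} [Finite ι] [Finite κ] {A : ι → M.Obj} {B : M.Obj}
    (σ : κ ≃ ι) (f : M.Hom A B), map (M.reindex σ f) = N.reindex σ (map f)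

/-- The category of (small) symmetric multicategories and their functors. -/
instance SymMulticat.category : Category SymMulticat.{w} where
  Hom M N := MFunctor M N
  id M :=
    { obj := fun A => A
      map := fun f => f
      map_id := fun _ => rfl
      map_comp := fun _ _ => rfl
      map_reindex := fun _ _ => rfl }
  comp F G :=
    { obj := fun A => G.obj (F.obj A)
      map := fun f => G.map (F.map f)
      map_id := fun A => by rw [F.map_id, G.map_id]
      map_comp := fun f g => by rw [F.map_comp, G.map_comp]
      map_reindex := fun σ f => by rw [F.map_reindex, G.map_reindex] }

namespace SymMulticat

/-! ### Elementary calculus of reindexing -/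

section Calculus

variable {M : SymMulticat.{w}}

theorem reindex_heq {ι κ : Type} [Finite ι] [Finite κ] {A : ι → M.Obj} {B : M.Obj}
    {σ τ : κ ≃ ι} (h : σ = τ) (f : M.Hom A B) : HEq (M.reindex σ f) (M.reindex τ f) := by
  subst h; rfl

theorem eq_reindex_symm {ι κ : Type} [Finite ι] [Finite κ] {A : ι → M.Obj} {B : M.Obj}
    (σ : κ ≃ ι) (f : M.Hom A B) (g : M.Hom (fun k => A (σ k)) B)
    (h : g = M.reindex σ f) : HEq (M.reindex σ.symm g) f := by
  subst h
  rw [M.reindex_trans]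
  have e : σ.symm.trans σ = Equiv.refl ι := by ext; simp
  exact (reindex_heq e f).trans (heq_of_eq (M.reindex_refl f))

theorem reindex_injective {ι κ : Type} [Finite ι] [Finite κ] {A : ι → M.Obj} {B : M.Obj}
    (σ : κ ≃ ι) {f g : M.Hom A B} (h : M.reindex σ f = M.reindex σ g) : f = g :=
  eq_of_heq ((eq_reindex_symm σ f _ rfl).symm.trans
    ((heq_of_eq (congrArg (M.reindex σ.symm) h)).trans (eq_reindex_symm σ g _ rfl)))

theorem reindex_of_eq {ι κ l : Type} [Finite ι] [Finite κ] [Finite l] {A : ι → M.Obj}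
    {B : M.Obj} (σ : κ ≃ ι) (τ : l ≃ κ) (f : M.Hom A B)
    (g : M.Hom (fun k => A (σ k)) B) (h : g = M.reindex σ f) :
    M.reindex τ g = M.reindex (τ.trans σ) f := by
  subst h
  exact M.reindex_trans σ τ f

theorem reindex_of_eq_self {ι κ : Type} [Finite ι] [Finite κ] {A : ι → M.Obj}
    {B : M.Obj} (σ : κ ≃ ι) (τ : ι ≃ κ) (f : M.Hom A B)
    (g : M.Hom (fun k => A (σ k)) B) (h : g = M.reindex σ f) (e : τ.trans σ = Equiv.refl ι) :
    HEq (M.reindex τ g) f :=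
  (heq_of_eq (reindex_of_eq σ τ f g h)).trans
    ((reindex_heq e f).trans (heq_of_eq (M.reindex_refl f)))

theorem eq_reindex_of_const {ι ι' κ : Type} [Finite ι] [Finite ι'] [Finite κ] {X B : M.Obj}
    (σ : κ ≃ ι) (τ : κ ≃ ι') (f : M.Hom (fun _ : ι => X) B) (g : M.Hom (fun _ : ι' => X) B)
    (h : M.reindex σ f = M.reindex τ g) : f = M.reindex (σ.symm.trans τ) g := by
  have h1 := eq_of_heq (eq_reindex_symm σ f (M.reindex τ g) h.symm)
  exact h1.symm.trans (M.reindex_trans τ σ.symm g)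

end Calculus

/-! ### The underlying category -/

/-- Composition of unary arrows, as a unary arrow. -/
def unaryComp (M : SymMulticat.{w}) {A B C : M.Obj}
    (g : M.Hom (fun _ : Unit => B) C) (f : M.Hom (fun _ : Unit => A) B) :
    M.Hom (fun _ : Unit => A) C :=
  M.reindex (unitSigma Unit).symm (M.comp g (fun _ => f))

/-- Substituting an arrow into the composite of two unary arrows. -/
theorem unaryComp_comp (M : SymMulticat.{w}) {A B C : M.Obj}
    (g : M.Hom (fun _ : Unit => B) C) (f : M.Hom (fun _ : Unit => A) B)
    {ι : Type} [Finite ι] {X : ι → M.Obj} (h : M.Hom X A) :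
    M.comp (M.unaryComp g f) (fun _ => h) =
      M.reindex (Equiv.sigmaCongrRight fun _ : Unit => (unitSigma ι).symm)
        (M.comp g (fun _ => M.comp f (fun _ => h))) := by
  have h1 := M.assoc g (fun _ => f) (fun _ _ => h)
  have h2 := M.comp_reindex_left (M.comp g (fun _ : Unit => f))
    (fun _ => h) (unitSigma Unit).symm
  have h3 := reindex_of_eq (Equiv.sigmaAssoc fun (_ : Unit) (_ : Unit) => ι)
    (Equiv.sigmaCongrLeft (β := fun _ : Σ _ : Unit, Unit => ι) (unitSigma Unit).symm)
    (M.comp g (fun _ : Unit => M.comp f (fun _ => h))) _ h1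
  exact h2.trans h3

/-- Substituting the composites of two families of unary arrows. -/
theorem comp_unaryComp (M : SymMulticat.{w}) {ι : Type} [Finite ι] {A B C : ι → M.Obj}
    {D : M.Obj} (h : M.Hom C D) (g : ∀ i, M.Hom (fun _ : Unit => B i) (C i))
    (f : ∀ i, M.Hom (fun _ : Unit => A i) (B i)) :
    M.comp h (fun i => M.unaryComp (g i) (f i)) =
      M.reindex (Equiv.sigmaCongrLeft (β := fun _ : ι => Unit) (sigmaUnit ι)).symm
        (M.comp (M.comp h g) (fun p => f p.1)) := by
  have h1 := M.assoc h g (fun i _ => f i)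
  have h2 := M.comp_reindex_right h (fun i => M.comp (g i) (fun _ => f i))
    (fun _ => (unitSigma Unit).symm)
  have h3 := reindex_of_eq (Equiv.sigmaAssoc fun (_ : ι) (_ : Unit) => Unit)
    (Equiv.sigmaCongrLeft (β := fun _ : ι => Unit) (sigmaUnit ι)).symm
    (M.comp h (fun i => M.comp (g i) (fun _ => f i))) _ h1
  exact h2.trans h3.symm

theorem unaryComp_id (M : SymMulticat.{w}) {A B : M.Obj}
    (f : M.Hom (fun _ : Unit => A) B) : M.unaryComp f (M.id A) = f := by
  exact eq_of_heq (reindex_of_eq_self (sigmaUnit Unit) (unitSigma Unit).symm f _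
    (M.comp_id f) (by ext))

theorem id_unaryComp (M : SymMulticat.{w}) {A B : M.Obj}
    (f : M.Hom (fun _ : Unit => A) B) : M.unaryComp (M.id B) f = f := by
  exact eq_of_heq (reindex_of_eq_self (unitSigma Unit) (unitSigma Unit).symm f _
    (M.id_comp f) (by ext))

theorem unaryComp_assoc (M : SymMulticat.{w}) {A B C D : M.Obj}
    (h : M.Hom (fun _ : Unit => C) D) (g : M.Hom (fun _ : Unit => B) C)
    (f : M.Hom (fun _ : Unit => A) B) :
    M.unaryComp (M.unaryComp h g) f = M.unaryComp h (M.unaryComp g f) := by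
  have h1 := M.unaryComp_comp h g f
  have h2 := M.comp_reindex_right h (fun _ => M.comp g (fun _ => f))
    (fun _ => (unitSigma Unit).symm)
  exact congrArg (M.reindex (unitSigma Unit).symm) (h1.trans h2.symm)

theorem _root_.MFunctor.map_unaryComp {M N : SymMulticat.{w}} (F : MFunctor M N)
    {A B C : M.Obj} (g : M.Hom (fun _ : Unit => B) C) (f : M.Hom (fun _ : Unit => A) B) :
    F.map (M.unaryComp g f) = N.unaryComp (F.map g) (F.map f) := by
  unfold unaryComp
  rw [F.map_reindex, F.map_comp]

/-- The underlying category `M_-` of `M`: the objects of `M` and the unary arrows between them. -/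
structure Und (M : SymMulticat.{w}) : Type w where
  of ::
  obj : M.Obj

instance (M : SymMulticat.{w}) : Category.{w} M.Und where
  Hom A B := M.Hom (fun _ : Unit => A.obj) B.obj
  id A := M.id A.obj
  comp f g := M.unaryComp g f
  id_comp f := M.unaryComp_id f
  comp_id f := M.id_unaryComp f
  assoc f g h := (M.unaryComp_assoc h g f).symm

/-- The underlying functor `(-)_- : sMlt ⥤ Cat`. -/
def und : SymMulticat.{w} ⥤ Cat.{w, w} where
  obj M := Cat.of M.Und
  map {M N} F := Functor.toCatHom (C := M.Und) (D := N.Und)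
    { obj := fun A => ⟨MFunctor.obj F A.obj⟩
      map := fun f => MFunctor.map F f
      map_id := fun A => MFunctor.map_id F A.obj
      map_comp := fun f g => MFunctor.map_unaryComp F g f }

/-! ### Sequential multicategories -/

/-- The discrete cocone multicategory `C_▸`: an arrow `(A i)_{i ∈ ι} → B` is a family of arrows
`A i ⟶ B` of `C`. -/
def seq (C : Type w) [Category.{w} C] : SymMulticat.{w} where
  Obj := C
  Hom {ι} _ A B := ∀ i : ι, A i ⟶ B
  id A := fun _ => 𝟙 A
  comp f g := fun p => g p.1 p.2 ≫ f p.1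
  reindex σ f := fun k => f (σ k)
  id_comp f := by funext p; exact Category.comp_id _
  comp_id f := by funext p; exact Category.id_comp _
  assoc f g h := by funext p; exact (Category.assoc _ _ _).symm
  reindex_refl _ := rfl
  reindex_trans _ _ _ := rfl
  comp_reindex_right _ _ _ := rfl
  comp_reindex_left _ _ _ := rfl

/-- The sequential embedding `(-)_▸ : Cat ⥤ sMlt`. -/
def seqFunctor : Cat.{w, w} ⥤ SymMulticat.{w} where
  obj C := seq C
  map {C D} F := show MFunctor (seq C) (seq D) from
    { obj := fun A => F.toFunctor.obj A
      map := fun f i => F.toFunctor.map (f i)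
      map_id := fun A => by funext i; exact F.toFunctor.map_id A
      map_comp := fun f g => by funext p; exact F.toFunctor.map_comp _ _
      map_reindex := fun _ _ => rfl }

/-- A symmetric multicategory is sequential if it is isomorphic to some `C_▸`. -/
def IsSequential : ObjectProperty SymMulticat.{w} :=
  fun M => ∃ C : Cat.{w, w}, Nonempty (M ≅ seqFunctor.obj C)

/-- `1_▸`, where `1` is the terminal category. -/
def one : SymMulticat.{w} := seqFunctor.obj (Cat.of (Discrete PUnit.{w + 1}))

/-- The unique object of `1_▸`. -/
def star : one.{w}.Obj := Discrete.mk PUnit.unit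

/-! ### The internal hom -/

/-- The commuting condition for a family of arrows `α_A : F₁A, …, FₙA → GA`. -/
def IsMultinatural {M N : SymMulticat.{w}} {ι : Type} [Finite ι] (F : ι → MFunctor M N)
    (G : MFunctor M N) (α : ∀ A : M.Obj, N.Hom (fun i => (F i).obj A) (G.obj A)) : Prop :=
  ∀ {κ : Type} [Finite κ] {A : κ → M.Obj} {B : M.Obj} (f : M.Hom A B),
    N.comp (G.map f) (fun k => α (A k)) =
      N.reindex (sigmaSwap κ ι) (N.comp (α B) (fun i => (F i).map f))

theorem isMultinatural_id {M N : SymMulticat.{w}} (F : MFunctor M N) :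
    IsMultinatural (fun _ : Unit => F) F (fun A => N.id (F.obj A)) := by
  intro κ _ A B f
  exact (N.comp_id (F.map f)).trans
    (reindex_of_eq (unitSigma κ) (sigmaSwap κ Unit) (F.map f) _ (N.id_comp (F.map f))).symm

theorem isMultinatural_reindex {M N : SymMulticat.{w}} {ι ι' : Type} [Finite ι] [Finite ι']
    {F : ι → MFunctor M N} {G : MFunctor M N}
    {α : ∀ A : M.Obj, N.Hom (fun i => (F i).obj A) (G.obj A)}
    (hα : IsMultinatural F G α) (σ : ι' ≃ ι) :
    IsMultinatural (fun k => F (σ k)) G (fun A => N.reindex σ (α A)) := by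
  intro κ _ A B f
  have h1 := N.comp_reindex_right (G.map f) (fun k => α (A k)) (fun _ => σ)
  have h2 := N.comp_reindex_left (α B) (fun i => (F i).map f) σ
  have h3 := reindex_of_eq (sigmaSwap κ ι) (Equiv.sigmaCongrRight fun _ : κ => σ)
    (N.comp (α B) (fun i => (F i).map f)) _ (hα f)
  have h4 := reindex_of_eq (Equiv.sigmaCongrLeft (β := fun _ : ι => κ) σ) (sigmaSwap κ ι')
    (N.comp (α B) (fun i => (F i).map f)) _ h2
  have h5 : (sigmaSwap κ ι').trans (Equiv.sigmaCongrLeft (β := fun _ : ι => κ) σ) =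
      (Equiv.sigmaCongrRight fun _ : κ => σ).trans (sigmaSwap κ ι) := Equiv.ext fun _ => rfl
  exact h1.trans (h3.trans ((eq_of_heq (reindex_heq h5 _)).symm.trans h4.symm))

theorem isMultinatural_comp {M N : SymMulticat.{w}} {ι : Type} [Finite ι]
    {J : ι → Type} [∀ i, Finite (J i)] {H : ∀ i, J i → MFunctor M N}
    {F : ι → MFunctor M N} {G : MFunctor M N}
    {α : ∀ A : M.Obj, N.Hom (fun i => (F i).obj A) (G.obj A)}
    {β : ∀ i, ∀ A : M.Obj, N.Hom (fun j => (H i j).obj A) ((F i).obj A)}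
    (hα : IsMultinatural F G α) (hβ : ∀ i, IsMultinatural (H i) (F i) (β i)) :
    IsMultinatural (fun p : Σ i, J i => H p.1 p.2) G
      (fun A => N.comp (α A) (fun i => β i A)) := by
  intro κ _ A B f
  have h1 := N.assoc (G.map f) (fun k => α (A k)) (fun k i => β i (A k))
  have h2 := N.comp_reindex_left (N.comp (α B) (fun i => (F i).map f))
    (fun q : Σ _ : ι, κ => β q.1 (A q.2)) (sigmaSwap κ ι)
  have h3 := N.assoc (α B) (fun i => (F i).map f) (fun i k => β i (A k))
  have h4 := N.comp_reindex_right (α B)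
    (fun i => N.comp (β i B) (fun j => (H i j).map f)) (fun i => sigmaSwap κ (J i))
  have h5 := N.assoc (α B) (fun i => β i B) (fun i j => (H i j).map f)
  have h6 : (fun i => N.comp ((F i).map f) (fun k => β i (A k))) =
      fun i => N.reindex (sigmaSwap κ (J i)) (N.comp (β i B) (fun j => (H i j).map f)) :=
    funext fun i => hβ i f
  let Z := N.comp (α B) (fun i => N.comp (β i B) (fun j => (H i j).map f))
  let s₁ := Equiv.sigmaCongrRight fun i => sigmaSwap κ (J i)
  let s₂ := Equiv.sigmaAssoc fun (i : ι) (_ : κ) => J i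
  let s₃ := Equiv.sigmaCongrLeft (β := fun q : Σ _ : ι, κ => J q.1) (sigmaSwap κ ι)
  let s₄ := Equiv.sigmaAssoc fun (_ : κ) (i : ι) => J i
  let s₅ := Equiv.sigmaAssoc fun (i : ι) (_ : J i) => κ
  let s₆ := sigmaSwap κ (Σ i, J i)
  have h7 := reindex_of_eq s₁ s₂ Z _ ((congrArg (N.comp (α B)) h6).trans h4)
  have h8 := reindex_of_eq (s₂.trans s₁) s₃ Z _ (h3.trans h7)
  have h9 := (congrArg (fun t => N.comp t (fun p : Σ _ : κ, ι => β p.2 (A p.1))) (hα f)).trans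
    (h2.trans h8)
  have h10 := reindex_of_eq s₅ s₆ Z _ h5
  have h11 := reindex_of_eq (s₆.trans s₅) s₄ Z _ h10
  exact reindex_injective s₄ (h1.symm.trans (h9.trans h11.symm))

/-- The internal hom `[M, N]`. Its objects are the functors `M → N`; its arrows
`F₁, …, Fₙ → G` are the multinatural families, with pointwise structure. -/
def ihom (M N : SymMulticat.{u + 1}) : SymMulticat.{u + 1} where
  Obj := MFunctor M N
  Hom F G := { α : ∀ A : M.Obj, N.Hom (fun i => (F i).obj A) (G.obj A) // IsMultinatural F G α }
  id F := ⟨fun A => N.id (F.obj A), isMultinatural_id F⟩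
  comp α β := ⟨fun A => N.comp (α.1 A) (fun i => (β i).1 A),
    isMultinatural_comp α.2 (fun i => (β i).2)⟩
  reindex σ α := ⟨fun A => N.reindex σ (α.1 A), isMultinatural_reindex α.2 σ⟩
  id_comp α := Subtype.ext (funext fun A => N.id_comp (α.1 A))
  comp_id α := Subtype.ext (funext fun A => N.comp_id (α.1 A))
  assoc α β γ := Subtype.ext (funext fun A =>
    N.assoc (α.1 A) (fun i => (β i).1 A) (fun i k => (γ i k).1 A))
  reindex_refl α := Subtype.ext (funext fun A => N.reindex_refl (α.1 A))
  reindex_trans σ τ α := Subtype.ext (funext fun A => N.reindex_trans σ τ (α.1 A))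
  comp_reindex_right α β σ := Subtype.ext (funext fun A =>
    N.comp_reindex_right (α.1 A) (fun i => (β i).1 A) σ)
  comp_reindex_left α β σ := Subtype.ext (funext fun A =>
    N.comp_reindex_left (α.1 A) (fun i => (β i).1 A) σ)

/-- The functor `[M, -] : sMlt ⥤ sMlt`, acting by postcomposition. -/
def ihomFunctor (M : SymMulticat.{u + 1}) : SymMulticat.{u + 1} ⥤ SymMulticat.{u + 1} where
  obj N := ihom M N
  map {N N'} K := show MFunctor (ihom M N) (ihom M N') from
    { obj := fun F => (show M ⟶ N from F) ≫ K
      map := fun {ι _ F G} α => ⟨fun A => MFunctor.map K (α.1 A), by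
        intro κ _ A B f
        have h := congrArg (MFunctor.map K) (α.2 f)
        exact ((MFunctor.map_comp K _ _).symm.trans h).trans
          ((MFunctor.map_reindex K _ _).trans
            (congrArg (N'.reindex (sigmaSwap κ ι)) (MFunctor.map_comp K _ _)))⟩
      map_id := fun F => Subtype.ext (funext fun A => MFunctor.map_id K (F.obj A))
      map_comp := fun α β => Subtype.ext (funext fun A =>
        MFunctor.map_comp K (α.1 A) (fun i => (β i).1 A))
      map_reindex := fun σ α => Subtype.ext (funext fun A =>
        MFunctor.map_reindex K σ (α.1 A)) }

/-- The canonical functor `[1_▸, M] → M`, which evaluates at the object of `1_▸`. -/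
def evaluation (M : SymMulticat.{u + 1}) : (ihomFunctor one).obj M ⟶ M :=
  show MFunctor (ihom one M) M from
    { obj := fun F => F.obj star
      map := fun α => α.1 star
      map_id := fun _ => rfl
      map_comp := fun _ _ => rfl
      map_reindex := fun _ _ => rfl }

/-! ### The Boardman-Vogt tensor product -/

/-- Formal arrows of `M ⊗ N`: the formal composites and reindexings of the generators
`f_X` (`left f X`) and `h_A` (`right A h`). -/
inductive Formal (M N : SymMulticat.{u + 1}) :
    {ι : Type} → [Finite ι] → (ι → M.Obj × N.Obj) → M.Obj × N.Obj → Type (u + 1)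
  | left {ι : Type} [Finite ι] {A : ι → M.Obj} {B : M.Obj} (f : M.Hom A B) (X : N.Obj) :
      Formal M N (fun i => (A i, X)) (B, X)
  | right {ι : Type} [Finite ι] {X : ι → N.Obj} {Y : N.Obj} (A : M.Obj) (h : N.Hom X Y) :
      Formal M N (fun i => (A, X i)) (A, Y)
  | id (P : M.Obj × N.Obj) : Formal M N (fun _ : Unit => P) P
  | comp {ι : Type} [Finite ι] {κ : ι → Type} [∀ i, Finite (κ i)]
      {P : ι → M.Obj × N.Obj} {Q : M.Obj × N.Obj} {R : (i : ι) → κ i → M.Obj × N.Obj}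
      (s : Formal M N P Q) (t : (i : ι) → Formal M N (R i) (P i)) :
      Formal M N (fun p : Σ i, κ i => R p.1 p.2) Q
  | reindex {ι κ : Type} [Finite ι] [Finite κ] {P : ι → M.Obj × N.Obj} {Q : M.Obj × N.Obj}
      (σ : κ ≃ ι) (s : Formal M N P Q) : Formal M N (fun k => P (σ k)) Q

/-- The congruence on formal arrows generated by the laws of symmetric multicategories,
the functoriality of `(-)_X` and of `(-)_A`, and the commuting relation between the `f_X`
and the `h_A`. -/
inductive Formal.Rel (M N : SymMulticat.{u + 1}) :
    {ι : Type} → [Finite ι] → {P : ι → M.Obj × N.Obj} → {Q : M.Obj × N.Obj} →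
    Formal M N P Q → Formal M N P Q → Prop
  -- equivalence relation and congruence
  | refl {ι : Type} [Finite ι] {P : ι → M.Obj × N.Obj} {Q : M.Obj × N.Obj}
      (s : Formal M N P Q) : Rel M N s s
  | symm {ι : Type} [Finite ι] {P : ι → M.Obj × N.Obj} {Q : M.Obj × N.Obj}
      {s t : Formal M N P Q} : Rel M N s t → Rel M N t s
  | trans {ι : Type} [Finite ι] {P : ι → M.Obj × N.Obj} {Q : M.Obj × N.Obj}
      {s t r : Formal M N P Q} : Rel M N s t → Rel M N t r → Rel M N s r
  | comp_congr {ι : Type} [Finite ι] {κ : ι → Type} [∀ i, Finite (κ i)]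
      {P : ι → M.Obj × N.Obj} {Q : M.Obj × N.Obj} {R : (i : ι) → κ i → M.Obj × N.Obj}
      {s s' : Formal M N P Q} {t t' : (i : ι) → Formal M N (R i) (P i)} :
      Rel M N s s' → (∀ i, Rel M N (t i) (t' i)) → Rel M N (s.comp t) (s'.comp t')
  | reindex_congr {ι κ : Type} [Finite ι] [Finite κ] {P : ι → M.Obj × N.Obj}
      {Q : M.Obj × N.Obj} (σ : κ ≃ ι) {s s' : Formal M N P Q} :
      Rel M N s s' → Rel M N (s.reindex σ) (s'.reindex σ)
  -- laws of symmetric multicategories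
  | id_comp {ι : Type} [Finite ι] {P : ι → M.Obj × N.Obj} {Q : M.Obj × N.Obj}
      (s : Formal M N P Q) :
      Rel M N ((Formal.id Q).comp (fun _ : Unit => s)) (s.reindex (unitSigma ι))
  | comp_id {ι : Type} [Finite ι] {P : ι → M.Obj × N.Obj} {Q : M.Obj × N.Obj}
      (s : Formal M N P Q) :
      Rel M N (s.comp (fun i => Formal.id (P i))) (s.reindex (sigmaUnit ι))
  | assoc {ι : Type} [Finite ι] {κ : ι → Type} [∀ i, Finite (κ i)]
      {l : (i : ι) → κ i → Type} [∀ i k, Finite (l i k)]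
      {P : ι → M.Obj × N.Obj} {Q : M.Obj × N.Obj} {R : (i : ι) → κ i → M.Obj × N.Obj}
      {S : (i : ι) → (k : κ i) → l i k → M.Obj × N.Obj}
      (s : Formal M N P Q) (t : (i : ι) → Formal M N (R i) (P i))
      (r : (i : ι) → (k : κ i) → Formal M N (S i k) (R i k)) :
      Rel M N ((s.comp t).comp (fun p : Σ i, κ i => r p.1 p.2))
        ((s.comp (fun i => (t i).comp (r i))).reindex (Equiv.sigmaAssoc l))
  | reindex_refl {ι : Type} [Finite ι] {P : ι → M.Obj × N.Obj} {Q : M.Obj × N.Obj}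
      (s : Formal M N P Q) : Rel M N (s.reindex (Equiv.refl ι)) s
  | reindex_trans {ι κ l : Type} [Finite ι] [Finite κ] [Finite l]
      {P : ι → M.Obj × N.Obj} {Q : M.Obj × N.Obj} (σ : κ ≃ ι) (τ : l ≃ κ)
      (s : Formal M N P Q) : Rel M N ((s.reindex σ).reindex τ) (s.reindex (τ.trans σ))
  | comp_reindex_right {ι : Type} [Finite ι] {κ l : ι → Type} [∀ i, Finite (κ i)]
      [∀ i, Finite (l i)] {P : ι → M.Obj × N.Obj} {Q : M.Obj × N.Obj}
      {R : (i : ι) → κ i → M.Obj × N.Obj} (s : Formal M N P Q)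
      (t : (i : ι) → Formal M N (R i) (P i)) (σ : (i : ι) → l i ≃ κ i) :
      Rel M N (s.comp (fun i => (t i).reindex (σ i)))
        ((s.comp t).reindex (Equiv.sigmaCongrRight σ))
  | comp_reindex_left {ι ι' : Type} [Finite ι] [Finite ι'] {κ : ι → Type} [∀ i, Finite (κ i)]
      {P : ι → M.Obj × N.Obj} {Q : M.Obj × N.Obj} {R : (i : ι) → κ i → M.Obj × N.Obj}
      (s : Formal M N P Q) (t : (i : ι) → Formal M N (R i) (P i)) (σ : ι' ≃ ι) :
      Rel M N ((s.reindex σ).comp (fun i => t (σ i)))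
        ((s.comp t).reindex (Equiv.sigmaCongrLeft (β := κ) σ))
  -- functoriality of `(-)_X`
  | left_id (A : M.Obj) (X : N.Obj) : Rel M N (Formal.left (M.id A) X) (Formal.id (A, X))
  | left_comp {ι : Type} [Finite ι] {κ : ι → Type} [∀ i, Finite (κ i)]
      {A : ι → M.Obj} {B : M.Obj} {C : (i : ι) → κ i → M.Obj}
      (f : M.Hom A B) (g : (i : ι) → M.Hom (C i) (A i)) (X : N.Obj) :
      Rel M N (Formal.left (M.comp f g) X)
        ((Formal.left f X).comp (fun i => Formal.left (g i) X))
  | left_reindex {ι κ : Type} [Finite ι] [Finite κ] {A : ι → M.Obj} {B : M.Obj}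
      (σ : κ ≃ ι) (f : M.Hom A B) (X : N.Obj) :
      Rel M N (Formal.left (M.reindex σ f) X) ((Formal.left f X).reindex σ)
  -- functoriality of `(-)_A`
  | right_id (A : M.Obj) (X : N.Obj) : Rel M N (Formal.right A (N.id X)) (Formal.id (A, X))
  | right_comp {ι : Type} [Finite ι] {κ : ι → Type} [∀ i, Finite (κ i)]
      {X : ι → N.Obj} {Y : N.Obj} {Z : (i : ι) → κ i → N.Obj} (A : M.Obj)
      (h : N.Hom X Y) (k : (i : ι) → N.Hom (Z i) (X i)) :
      Rel M N (Formal.right A (N.comp h k))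
        ((Formal.right A h).comp (fun i => Formal.right A (k i)))
  | right_reindex {ι κ : Type} [Finite ι] [Finite κ] {X : ι → N.Obj} {Y : N.Obj}
      (A : M.Obj) (σ : κ ≃ ι) (h : N.Hom X Y) :
      Rel M N (Formal.right A (N.reindex σ h)) ((Formal.right A h).reindex σ)
  -- the commuting relation
  | interchange {ι κ : Type} [Finite ι] [Finite κ] {A : ι → M.Obj} {B : M.Obj}
      {X : κ → N.Obj} {Y : N.Obj} (f : M.Hom A B) (h : N.Hom X Y) :
      Rel M N ((Formal.left f Y).comp (fun i => Formal.right (A i) h))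
        (((Formal.right B h).comp (fun k => Formal.left f (X k))).reindex (sigmaSwap ι κ))

instance Formal.setoid (M N : SymMulticat.{u + 1}) {ι : Type} [Finite ι]
    (P : ι → M.Obj × N.Obj) (Q : M.Obj × N.Obj) : Setoid (Formal M N P Q) where
  r := Formal.Rel M N
  iseqv := ⟨Formal.Rel.refl, Formal.Rel.symm, Formal.Rel.trans⟩

/-- Arrows of `M ⊗ N`: formal arrows up to congruence. -/
def TensorHom (M N : SymMulticat.{u + 1}) {ι : Type} [Finite ι]
    (P : ι → M.Obj × N.Obj) (Q : M.Obj × N.Obj) : Type (u + 1) :=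
  Quotient (Formal.setoid M N P Q)

/-- The arrow of `M ⊗ N` represented by a formal arrow. -/
def TensorHom.mk {M N : SymMulticat.{u + 1}} {ι : Type} [Finite ι]
    {P : ι → M.Obj × N.Obj} {Q : M.Obj × N.Obj} (s : Formal M N P Q) : TensorHom M N P Q :=
  Quotient.mk _ s

/-- A representative of an arrow of `M ⊗ N`. -/
noncomputable def TensorHom.rep {M N : SymMulticat.{u + 1}} {ι : Type} [Finite ι]
    {P : ι → M.Obj × N.Obj} {Q : M.Obj × N.Obj} (s : TensorHom M N P Q) : Formal M N P Q :=
  Quotient.out s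

section

variable {M N : SymMulticat.{u + 1}} {ι : Type} [Finite ι]
  {P : ι → M.Obj × N.Obj} {Q : M.Obj × N.Obj}

theorem TensorHom.mk_eq {s t : Formal M N P Q} (h : Formal.Rel M N s t) :
    TensorHom.mk s = TensorHom.mk t :=
  Quotient.sound h

theorem TensorHom.mk_rep (s : TensorHom M N P Q) : TensorHom.mk s.rep = s :=
  Quotient.out_eq s

theorem TensorHom.rep_mk (s : Formal M N P Q) : Formal.Rel M N (TensorHom.mk s).rep s :=
  Quotient.mk_out (s := Formal.setoid M N P Q) s

theorem TensorHom.ind {p : TensorHom M N P Q → Prop} (h : ∀ s, p (TensorHom.mk s))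
    (s : TensorHom M N P Q) : p s :=
  Quotient.ind h s

end

/-- The Boardman-Vogt tensor product `M ⊗ N`. (The operations are defined on representatives;
`tensor_comp_mk` and `tensor_reindex_mk` show that the choice is immaterial.) -/
noncomputable def tensor (M N : SymMulticat.{u + 1}) : SymMulticat.{u + 1} where
  Obj := M.Obj × N.Obj
  Hom P Q := TensorHom M N P Q
  id P := TensorHom.mk (Formal.id P)
  comp s t := TensorHom.mk (s.rep.comp (fun i => (t i).rep))
  reindex σ s := TensorHom.mk (s.rep.reindex σ)
  id_comp s := TensorHom.mk_eq ((Formal.Rel.comp_congr (TensorHom.rep_mk _)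
    (fun _ => Formal.Rel.refl _)).trans (Formal.Rel.id_comp s.rep))
  comp_id s := TensorHom.mk_eq ((Formal.Rel.comp_congr (Formal.Rel.refl _)
    (fun _ => TensorHom.rep_mk _)).trans (Formal.Rel.comp_id s.rep))
  assoc s t r := TensorHom.mk_eq (((Formal.Rel.comp_congr (TensorHom.rep_mk _)
    (fun _ => Formal.Rel.refl _)).trans
      (Formal.Rel.assoc s.rep (fun i => (t i).rep) (fun i k => (r i k).rep))).trans
    (Formal.Rel.reindex_congr _ ((Formal.Rel.comp_congr (Formal.Rel.refl _)
      (fun _ => (TensorHom.rep_mk _).symm)).trans (TensorHom.rep_mk _).symm)))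
  reindex_refl s :=
    (TensorHom.mk_eq (Formal.Rel.reindex_refl s.rep)).trans (TensorHom.mk_rep s)
  reindex_trans σ τ s := TensorHom.mk_eq
    ((Formal.Rel.reindex_congr τ (TensorHom.rep_mk _)).trans
      (Formal.Rel.reindex_trans σ τ s.rep))
  comp_reindex_right s t σ := TensorHom.mk_eq
    (((Formal.Rel.comp_congr (Formal.Rel.refl _) (fun _ => TensorHom.rep_mk _)).trans
      (Formal.Rel.comp_reindex_right s.rep (fun i => (t i).rep) σ)).trans
      (Formal.Rel.reindex_congr _ (TensorHom.rep_mk _).symm))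
  comp_reindex_left s t σ := TensorHom.mk_eq
    (((Formal.Rel.comp_congr (TensorHom.rep_mk _) (fun _ => Formal.Rel.refl _)).trans
      (Formal.Rel.comp_reindex_left s.rep (fun i => (t i).rep) σ)).trans
      (Formal.Rel.reindex_congr _ (TensorHom.rep_mk _).symm))

theorem tensor_comp_mk {M N : SymMulticat.{u + 1}} {ι : Type} [Finite ι] {κ : ι → Type}
    [∀ i, Finite (κ i)] {P : ι → M.Obj × N.Obj} {Q : M.Obj × N.Obj}
    {R : (i : ι) → κ i → M.Obj × N.Obj} (s : Formal M N P Q)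
    (t : (i : ι) → Formal M N (R i) (P i)) :
    (tensor M N).comp (A := P) (B := Q) (X := R)
      (TensorHom.mk s) (fun i => TensorHom.mk (t i)) = TensorHom.mk (s.comp t) :=
  TensorHom.mk_eq (Formal.Rel.comp_congr (TensorHom.rep_mk _) (fun _ => TensorHom.rep_mk _))

theorem tensor_reindex_mk {M N : SymMulticat.{u + 1}} {ι κ : Type} [Finite ι] [Finite κ]
    {P : ι → M.Obj × N.Obj} {Q : M.Obj × N.Obj} (σ : κ ≃ ι) (s : Formal M N P Q) :
    (tensor M N).reindex (A := P) (B := Q) σ (TensorHom.mk s) = TensorHom.mk (s.reindex σ) :=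
  TensorHom.mk_eq (Formal.Rel.reindex_congr σ (TensorHom.rep_mk _))

/-- The action of `M ⊗ K` on formal arrows, for a functor `K`: by recursion, `f_X ↦ f_{KX}`
and `h_A ↦ (Kh)_A`. -/
noncomputable def Formal.map (M : SymMulticat.{u + 1}) {N N' : SymMulticat.{u + 1}}
    (K : MFunctor N N') {ι : Type} [Finite ι] {P : ι → M.Obj × N.Obj} {Q : M.Obj × N.Obj}
    (s : Formal M N P Q) :
    Formal M N' (fun i => ((P i).1, K.obj (P i).2)) (Q.1, K.obj Q.2) :=
  Formal.rec
    (motive := fun {ι} _ P Q _ =>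
      Formal M N' (fun i : ι => ((P i).1, K.obj (P i).2)) (Q.1, K.obj Q.2))
    (fun f X => .left f (K.obj X))
    (fun A h => .right A (K.map h))
    (fun P => .id (P.1, K.obj P.2))
    (fun _ _ s t => .comp s t)
    (fun σ _ s => .reindex σ s)
    s

theorem Formal.map_rel (M : SymMulticat.{u + 1}) {N N' : SymMulticat.{u + 1}}
    (K : MFunctor N N') {ι : Type} [Finite ι] {P : ι → M.Obj × N.Obj} {Q : M.Obj × N.Obj}
    {s t : Formal M N P Q} (h : Formal.Rel M N s t) :
    Formal.Rel M N' (Formal.map M K s) (Formal.map M K t) := by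
  induction h with
  | refl s => exact .refl _
  | symm _ ih => exact .symm ih
  | trans _ _ ih₁ ih₂ => exact .trans ih₁ ih₂
  | comp_congr _ _ ih₁ ih₂ => exact .comp_congr ih₁ ih₂
  | reindex_congr σ _ ih => exact .reindex_congr σ ih
  | id_comp s => exact .id_comp _
  | comp_id s => exact .comp_id _
  | assoc s t r =>
    exact .assoc (Formal.map M K s) (fun i => Formal.map M K (t i))
      (fun i k => Formal.map M K (r i k))
  | reindex_refl s => exact .reindex_refl _
  | reindex_trans σ τ s => exact .reindex_trans σ τ _
  | comp_reindex_right s t σ => exact .comp_reindex_right _ _ σ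
  | comp_reindex_left s t σ =>
    exact .comp_reindex_left (Formal.map M K s)
      (fun i => Formal.map M K (t i)) σ
  | left_id A X => exact .left_id A _
  | left_comp f g X => exact .left_comp f g _
  | left_reindex σ f X => exact .left_reindex σ f _
  | right_id A X =>
    change Formal.Rel M N' (.right A (K.map (N.id X))) _
    rw [K.map_id]
    exact .right_id A _
  | right_comp A h k =>
    change Formal.Rel M N' (.right A (K.map (N.comp h k))) _
    rw [K.map_comp]
    exact .right_comp A _ _
  | right_reindex A σ h =>
    change Formal.Rel M N' (.right A (K.map (N.reindex σ h))) _
    rw [K.map_reindex]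
    exact .right_reindex A σ _
  | interchange f h => exact .interchange f (K.map h)

theorem Formal.map_id (M : SymMulticat.{u + 1}) {N : SymMulticat.{u + 1}}
    {ι : Type} [Finite ι] {P : ι → M.Obj × N.Obj} {Q : M.Obj × N.Obj} (s : Formal M N P Q) :
    Formal.map M (𝟙 N : N ⟶ N) s = s := by
  induction s with
  | left f X => rfl
  | right A h => rfl
  | id P => rfl
  | comp s t ih₁ ih₂ => exact congrArg₂ Formal.comp ih₁ (funext ih₂)
  | reindex σ s ih => exact congrArg (Formal.reindex σ) ih

theorem Formal.map_comp (M : SymMulticat.{u + 1}) {N N' N'' : SymMulticat.{u + 1}}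
    (K : N ⟶ N') (L : N' ⟶ N'') {ι : Type} [Finite ι] {P : ι → M.Obj × N.Obj}
    {Q : M.Obj × N.Obj} (s : Formal M N P Q) :
    Formal.map M (K ≫ L) s = Formal.map M L (Formal.map M K s) := by
  induction s with
  | left f X => rfl
  | right A h => rfl
  | id P => rfl
  | comp s t ih₁ ih₂ => exact congrArg₂ Formal.comp ih₁ (funext ih₂)
  | reindex σ s ih => exact congrArg (Formal.reindex σ) ih

/-- `M ⊗ K : M ⊗ N → M ⊗ N'` for `K : N → N'`. -/
noncomputable def tensorMap (M : SymMulticat.{u + 1}) {N N' : SymMulticat.{u + 1}}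
    (K : MFunctor N N') : MFunctor (tensor M N) (tensor M N') where
  obj (P : M.Obj × N.Obj) := (P.1, K.obj P.2)
  map s := TensorHom.mk (Formal.map M K (TensorHom.rep s))
  map_id P := TensorHom.mk_eq (Formal.map_rel M K (TensorHom.rep_mk (Formal.id P)))
  map_comp s t :=
    (TensorHom.mk_eq (Formal.map_rel M K (TensorHom.rep_mk _))).trans
      (tensor_comp_mk (Formal.map M K (TensorHom.rep s))
        (fun i => Formal.map M K (TensorHom.rep (t i)))).symm
  map_reindex σ s :=
    (TensorHom.mk_eq (Formal.map_rel M K (TensorHom.rep_mk _))).trans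
      (tensor_reindex_mk σ (Formal.map M K (TensorHom.rep s))).symm

/-- The functor `M ⊗ - : sMlt ⥤ sMlt`. -/
noncomputable def tensorFunctor (M : SymMulticat.{u + 1}) :
    SymMulticat.{u + 1} ⥤ SymMulticat.{u + 1} where
  obj N := tensor M N
  map K := tensorMap M K
  map_id N := by
    refine MFunctor.ext (x := tensorMap M (𝟙 N)) (y := 𝟙 (tensor M N)) rfl (heq_of_eq ?_)
    funext ι _ P Q s
    exact (congrArg TensorHom.mk (Formal.map_id M _)).trans (TensorHom.mk_rep s)
  map_comp {N N' N''} K L := by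
    refine MFunctor.ext (x := tensorMap M (K ≫ L))
      (y := (show tensor M N ⟶ tensor M N' from tensorMap M K) ≫
        (show tensor M N' ⟶ tensor M N'' from tensorMap M L)) rfl (heq_of_eq ?_)
    funext ι _ P Q s
    exact (congrArg TensorHom.mk (Formal.map_comp M K L _)).trans
      (TensorHom.mk_eq (Formal.map_rel M L (TensorHom.rep_mk _).symm))

/-- The canonical functor `M → 1_▸ ⊗ M`, `f ↦ f_⋆`. -/
noncomputable def insertion (M : SymMulticat.{u + 1}) : M ⟶ (tensorFunctor one).obj M :=
  show MFunctor M (tensor one M) from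
    { obj := fun X => show one.Obj × M.Obj from (star, X)
      map := fun h => TensorHom.mk (Formal.right star h)
      map_id := fun X => TensorHom.mk_eq (Formal.Rel.right_id star X)
      map_comp := fun h k => (TensorHom.mk_eq (Formal.Rel.right_comp star h k)).trans
        (tensor_comp_mk (Formal.right star h) (fun i => Formal.right star (k i))).symm
      map_reindex := fun σ h => (TensorHom.mk_eq (Formal.Rel.right_reindex star σ h)).trans
        (tensor_reindex_mk σ (Formal.right star h)).symm }

/-! ### Commutative monoids in a symmetric multicategory -/

/-- The arrow `m(f, g)`, for `m` a binary arrow `X, X → X`, `f : X, …, X → X` and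
`g : X, …, X → X`. -/
def comp₂ (M : SymMulticat.{w}) {X : M.Obj} (m : M.Hom (fun _ : Bool => X) X)
    {ι κ : Type} [Finite ι] [Finite κ]
    (f : M.Hom (fun _ : ι => X) X) (g : M.Hom (fun _ : κ => X) X) :
    M.Hom (fun _ : ι ⊕ κ => X) X :=
  M.reindex (Equiv.sumEquivSigmaBool ι κ)
    (M.comp (κ := fun b => bif b then κ else ι) (X := fun _ _ => X) m (fun b =>
      match b with
      | false => f
      | true => g))

/-- A commutative monoid in a symmetric multicategory. -/
structure CMonoid (M : SymMulticat.{w}) : Type w where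
  X : M.Obj
  /-- the multiplication `X, X → X` -/
  mul : M.Hom (fun _ : Bool => X) X
  /-- the unit `( ) → X` -/
  unit : M.Hom (fun _ : Empty => X) X
  /-- `m(m(x, y), z) = m(x, m(y, z))` -/
  mul_assoc : M.comp₂ mul mul (M.id X) =
    M.reindex (((Equiv.boolEquivPUnitSumPUnit.sumCongr (Equiv.refl Unit)).trans
      (Equiv.sumAssoc Unit Unit Unit)).trans
      ((Equiv.refl Unit).sumCongr Equiv.boolEquivPUnitSumPUnit.symm))
      (M.comp₂ mul (M.id X) mul)
  /-- `m(1, x) = x` -/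
  unit_mul : M.comp₂ mul unit (M.id X) = M.reindex (Equiv.emptySum Empty Unit) (M.id X)
  /-- `m(x, 1) = x` -/
  mul_unit : M.comp₂ mul (M.id X) unit = M.reindex (Equiv.sumEmpty Unit Empty) (M.id X)
  /-- `m(y, x) = m(x, y)` -/
  mul_comm : M.reindex Equiv.boolNot mul = mul

/-- A morphism of commutative monoids: a unary arrow `f` such that
`f(m(x, y)) = m(f(x), f(y))` and `f(1) = 1`. -/
@[ext]
structure CMonoid.Morphism {M : SymMulticat.{w}} (A B : CMonoid M) : Type w where
  hom : M.Hom (fun _ : Unit => A.X) B.X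
  map_mul : M.comp hom (fun _ => A.mul) =
    M.reindex (sigmaSwap Unit Bool) (M.comp B.mul (fun _ => hom))
  map_unit : M.comp hom (fun _ => A.unit) =
    M.reindex (sigmaSwap Unit Empty) (M.comp B.unit (fun _ => hom))

theorem commute_unaryComp {M : SymMulticat.{w}} {A B C : M.Obj} {ι : Type} [Finite ι]
    {a : M.Hom (fun _ : ι => A) A} {b : M.Hom (fun _ : ι => B) B}
    {c : M.Hom (fun _ : ι => C) C}
    {f : M.Hom (fun _ : Unit => A) B} {g : M.Hom (fun _ : Unit => B) C}
    (hf : M.comp f (fun _ => a) = M.reindex (sigmaSwap Unit ι) (M.comp b (fun _ => f)))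
    (hg : M.comp g (fun _ => b) = M.reindex (sigmaSwap Unit ι) (M.comp c (fun _ => g))) :
    M.comp (M.unaryComp g f) (fun _ => a) =
      M.reindex (sigmaSwap Unit ι) (M.comp c (fun _ => M.unaryComp g f)) := by
  have h1 := M.unaryComp_comp g f a
  have h2 := congrArg (fun t => M.comp g (fun _ : Unit => t)) hf
  have h3 := M.comp_reindex_right g (fun _ => M.comp b (fun _ => f))
    (fun _ => sigmaSwap Unit ι)
  have h4 := M.assoc g (fun _ => b) (fun _ _ => f)
  have h5 := congrArg (fun t => M.comp t (fun _ : Σ _ : Unit, ι => f)) hg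
  have h6 := M.comp_reindex_left (M.comp c (fun _ => g)) (fun _ => f) (sigmaSwap Unit ι)
  have h7 := M.comp_unaryComp c (fun _ => g) (fun _ => f)
  let W := M.comp g (fun _ => M.comp b (fun _ => f))
  let T := M.comp (M.comp c (fun _ => g)) (fun _ => f)
  let r₁ := Equiv.sigmaCongrRight fun _ : Unit => (unitSigma ι).symm
  let r₃ := Equiv.sigmaCongrRight fun _ : Unit => sigmaSwap Unit ι
  let r₄ := Equiv.sigmaAssoc fun (_ : Unit) (_ : ι) => Unit
  let r₆ := Equiv.sigmaCongrLeft (β := fun _ : Σ _ : ι, Unit => Unit) (sigmaSwap Unit ι)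
  let r₇ := (Equiv.sigmaCongrLeft (β := fun _ : ι => Unit) (sigmaUnit ι)).symm
  have h8 : W = M.reindex (r₄.symm.trans r₆) T :=
    eq_reindex_of_const r₄ r₆ W T (h4.symm.trans (h5.trans h6))
  have h9 := reindex_of_eq (r₄.symm.trans r₆) r₃ T W h8
  have h10 := reindex_of_eq (r₃.trans (r₄.symm.trans r₆)) r₁ T _ ((h2.trans h3).trans h9)
  have h11 := reindex_of_eq r₇ (sigmaSwap Unit ι) T _ h7
  refine h1.trans (h10.trans (Eq.trans ?_ h11.symm))
  exact eq_of_heq (reindex_heq (Equiv.ext fun _ => rfl) T)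

theorem commute_id {M : SymMulticat.{w}} {A : M.Obj} {ι : Type} [Finite ι]
    (a : M.Hom (fun _ : ι => A) A) :
    M.comp (M.id A) (fun _ => a) = M.reindex (sigmaSwap Unit ι) (M.comp a (fun _ => M.id A)) :=
  (M.id_comp a).trans (reindex_of_eq (sigmaUnit ι) (sigmaSwap Unit ι) a _ (M.comp_id a)).symm

instance (M : SymMulticat.{w}) : Category.{w} (CMonoid M) where
  Hom A B := CMonoid.Morphism A B
  id A := ⟨M.id A.X, commute_id A.mul, commute_id A.unit⟩
  comp f g := ⟨M.unaryComp g.hom f.hom, commute_unaryComp f.map_mul g.map_mul,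
    commute_unaryComp f.map_unit g.map_unit⟩
  id_comp f := CMonoid.Morphism.ext (M.unaryComp_id f.hom)
  comp_id f := CMonoid.Morphism.ext (M.id_unaryComp f.hom)
  assoc f g h := CMonoid.Morphism.ext (M.unaryComp_assoc h.hom g.hom f.hom).symm

theorem _root_.MFunctor.map_comp₂ {M N : SymMulticat.{w}} (F : MFunctor M N) {X : M.Obj}
    (m : M.Hom (fun _ : Bool => X) X) {ι κ : Type} [Finite ι] [Finite κ]
    (f : M.Hom (fun _ : ι => X) X) (g : M.Hom (fun _ : κ => X) X) :
    F.map (M.comp₂ m f g) = N.comp₂ (F.map m) (F.map f) (F.map g) := by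
  unfold comp₂
  refine (F.map_reindex _ _).trans (congrArg (N.reindex _) ((F.map_comp _ _).trans ?_))
  refine congrArg (N.comp (F.map m)) ?_
  funext b
  cases b <;> rfl

/-- The image of a commutative monoid under a functor. -/
def CMonoid.map {M N : SymMulticat.{w}} (F : MFunctor M N) (A : CMonoid M) : CMonoid N where
  X := F.obj A.X
  mul := F.map A.mul
  unit := F.map A.unit
  mul_assoc := by
    rw [← F.map_id, ← F.map_comp₂, ← F.map_comp₂, A.mul_assoc]
    exact F.map_reindex _ _
  unit_mul := by
    rw [← F.map_id, ← F.map_comp₂, A.unit_mul]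
    exact F.map_reindex _ _
  mul_unit := by
    rw [← F.map_id, ← F.map_comp₂, A.mul_unit]
    exact F.map_reindex _ _
  mul_comm := (F.map_reindex _ _).symm.trans (congrArg F.map A.mul_comm)

theorem _root_.MFunctor.map_commute {M N : SymMulticat.{w}} (F : MFunctor M N) {A B : M.Obj}
    {ι : Type} [Finite ι] {a : M.Hom (fun _ : ι => A) A} {b : M.Hom (fun _ : ι => B) B}
    {f : M.Hom (fun _ : Unit => A) B}
    (h : M.comp f (fun _ => a) = M.reindex (sigmaSwap Unit ι) (M.comp b (fun _ => f))) :
    N.comp (F.map f) (fun _ => F.map a) =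
      N.reindex (sigmaSwap Unit ι) (N.comp (F.map b) (fun _ => F.map f)) :=
  (F.map_comp f (fun _ => a)).symm.trans ((congrArg F.map h).trans
    ((F.map_reindex _ _).trans (congrArg (N.reindex (sigmaSwap Unit ι)) (F.map_comp _ _))))

/-- The functor `cMon(-) : sMlt ⥤ Cat`. -/
def cMonFunctor : SymMulticat.{w} ⥤ Cat.{w, w} where
  obj M := Cat.of (CMonoid M)
  map {M N} F := Functor.toCatHom (C := CMonoid M) (D := CMonoid N)
    { obj := fun A => A.map F
      map := fun f => ⟨MFunctor.map F f.hom, MFunctor.map_commute F f.map_mul,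
        MFunctor.map_commute F f.map_unit⟩
      map_id := fun A => CMonoid.Morphism.ext (MFunctor.map_id F A.X)
      map_comp := fun f g => CMonoid.Morphism.ext (MFunctor.map_unaryComp F g.hom f.hom) }

end SymMulticat

open SymMulticat

/-! An arrow of `C_▸` is a family of unary arrows. A multicategory has this form as soon as every
object carries folds `A, …, A → A` of all arities, functorial in the arity, with which all arrows
commute (`CentralFold`). A family of unary arrows is then glued by folding it, an arrow is
restricted to a place by filling the other places with nullary folds, and centrality makes the two
operations mutually inverse (`isSequential_of_centralFold`). In `[1_▸, M]` the folds of `F` are the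
images under `F` of the arrows of `1_▸`, and centrality is multinaturality. In `1_▸ ⊗ M` the folds
are the generators `f_X`, and centrality is the interchange relation, extended to all arrows by
induction on formal arrows.

In a sequential multicategory a functor from `1_▸` is determined by its object (`one_hom_ext`).
Hence a functor `1_▸ ⊗ M → C_▸` must send each `f_X` to identities, so it amounts to its restriction
to `M`. For a functor `K : C_▸ → [1_▸, M]`, an Eckmann–Hilton argument applies: the folds at `K A`
coming from `C_▸` and the pointwise ones are two functors from `1_▸` into the sequential `[1_▸, M]`
with the same object, so they agree and `K` is recovered from its evaluation. As `(-)_▸` is an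
equivalence from `Cat` to `Seq` whose inverse takes underlying categories, both adjunctions transfer
to `Cat`.

A functor `1_▸ → M` is a commutative monoid together with its iterated multiplications over
unordered finite sets. Coherence of the latter is reduced to that of finite products in an honest
commutative monoid: operations with labelled places, up to label-preserving bijections. An operation
is an iterated multiplication if substitution into it computes products (`IsFold`). Such operations
exist in each arity by induction, and labelling the places by themselves shows that they are unique;
uniqueness yields functoriality and the inverse bijections. -/

namespace SymMulticat

/-! ### Arrows that are reindexings of each other -/

section Reindexing

variable {M : SymMulticat.{w}}

/-- `g` is, up to equality of domains and codomains, the reindexing of `f` along `σ`. -/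
def IsReindexing {ι κ : Type} [Finite ι] [Finite κ] {A : ι → M.Obj} {B : M.Obj}
    {A' : κ → M.Obj} {B' : M.Obj} (σ : κ ≃ ι) (f : M.Hom A B) (g : M.Hom A' B') : Prop :=
  (fun k => A (σ k)) = A' ∧ B = B' ∧ HEq (M.reindex σ f) g

namespace IsReindexing

variable {ι κ l : Type} [Finite ι] [Finite κ] [Finite l] {A : ι → M.Obj} {B : M.Obj}
  {A' : κ → M.Obj} {B' : M.Obj} {A'' : l → M.Obj} {B'' : M.Obj}

theorem of_eq {σ : κ ≃ ι} {f : M.Hom A B} {g : M.Hom (fun k => A (σ k)) B}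
    (h : g = M.reindex σ f) : IsReindexing σ f g :=
  ⟨rfl, rfl, heq_of_eq h.symm⟩

theorem reindex (σ : κ ≃ ι) (f : M.Hom A B) : IsReindexing σ f (M.reindex σ f) :=
  of_eq rfl

theorem refl (f : M.Hom A B) : IsReindexing (Equiv.refl ι) f f :=
  of_eq (M.reindex_refl f).symm

theorem congr {σ τ : κ ≃ ι} {f : M.Hom A B} {g : M.Hom A' B'} (h : IsReindexing σ f g)
    (e : ∀ k, σ k = τ k) : IsReindexing τ f g := by
  obtain rfl := Equiv.ext e
  exact h

theorem trans {σ : κ ≃ ι} {τ : l ≃ κ} {f : M.Hom A B} {g : M.Hom A' B'} {k : M.Hom A'' B''}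
    (h : IsReindexing σ f g) (h' : IsReindexing τ g k) : IsReindexing (τ.trans σ) f k := by
  obtain ⟨rfl, rfl, h⟩ := h
  obtain ⟨rfl, rfl, h'⟩ := h'
  obtain rfl := eq_of_heq h
  obtain rfl := eq_of_heq h'
  exact of_eq (M.reindex_trans σ τ f)

theorem symm {σ : κ ≃ ι} {f : M.Hom A B} {g : M.Hom A' B'} (h : IsReindexing σ f g) :
    IsReindexing σ.symm g f := by
  obtain ⟨rfl, rfl, h⟩ := h
  obtain rfl := eq_of_heq h
  exact ⟨by simp, rfl, eq_reindex_symm σ f _ rfl⟩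

/-- This and `eq_reindex` end a calculation: a chain of relations accumulates one composite
bijection, which then only has to be evaluated pointwise, usually by `rfl`. -/
theorem eq {σ : ι ≃ ι} {f g : M.Hom A B} (h : IsReindexing σ f g) (e : ∀ i, σ i = i) : f = g := by
  obtain rfl : σ = Equiv.refl ι := Equiv.ext e
  obtain ⟨_, _, h⟩ := h
  exact (M.reindex_refl f).symm.trans (eq_of_heq h)

theorem eq_reindex {σ τ : κ ≃ ι} {f : M.Hom A B} {g : M.Hom (fun k => A (τ k)) B}
    (h : IsReindexing σ f g) (e : ∀ i, σ i = τ i) : g = M.reindex τ f :=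
  (eq_of_heq (h.congr e).2.2).symm

theorem comp {ι ι' : Type} [Finite ι] [Finite ι'] {κ : ι → Type} {κ' : ι' → Type}
    [∀ i, Finite (κ i)] [∀ i, Finite (κ' i)] {A : ι → M.Obj} {B : M.Obj}
    {X : (i : ι) → κ i → M.Obj} {A' : ι' → M.Obj} {B' : M.Obj} {X' : (i : ι') → κ' i → M.Obj}
    {σ : ι' ≃ ι} {τ : (i : ι') → κ' i ≃ κ (σ i)}
    {f : M.Hom A B} {f' : M.Hom A' B'} {g : (i : ι) → M.Hom (X i) (A i)}
    {g' : (i : ι') → M.Hom (X' i) (A' i)} (h : IsReindexing σ f f')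
    (h' : ∀ i, IsReindexing (τ i) (g (σ i)) (g' i)) :
    IsReindexing ((Equiv.sigmaCongrRight τ).trans (Equiv.sigmaCongrLeft (β := κ) σ))
      (M.comp f g) (M.comp f' g') := by
  obtain ⟨rfl, rfl, h⟩ := h
  obtain rfl := eq_of_heq h
  obtain rfl : (fun i k => X (σ i) (τ i k)) = X' := funext fun i => (h' i).1
  obtain rfl : (fun i => M.reindex (τ i) (g (σ i))) = g' :=
    funext fun i => eq_of_heq (h' i).2.2
  exact (of_eq (M.comp_reindex_left f g σ)).trans
    (of_eq (M.comp_reindex_right (M.reindex σ f) (fun i => g (σ i)) τ))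

theorem comp_right {κ κ' : ι → Type} [∀ i, Finite (κ i)] [∀ i, Finite (κ' i)]
    {X : (i : ι) → κ i → M.Obj} {X' : (i : ι) → κ' i → M.Obj}
    {τ : (i : ι) → κ' i ≃ κ i} (f : M.Hom A B) {g : (i : ι) → M.Hom (X i) (A i)}
    {g' : (i : ι) → M.Hom (X' i) (A i)}
    (h' : ∀ i, IsReindexing (τ i) (g i) (g' i)) :
    IsReindexing (Equiv.sigmaCongrRight τ) (M.comp f g) (M.comp f g') :=
  (comp (σ := Equiv.refl ι) (refl f) h').congr fun _ => rfl

theorem comp_left {ι' : Type} [Finite ι'] {κ : ι → Type} [∀ i, Finite (κ i)]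
    {X : (i : ι) → κ i → M.Obj} {σ : ι' ≃ ι} {f : M.Hom A B}
    {f' : M.Hom (fun i => A (σ i)) B} (h : IsReindexing σ f f') (g : (i : ι) → M.Hom (X i) (A i)) :
    IsReindexing (Equiv.sigmaCongrLeft (β := κ) σ) (M.comp f g) (M.comp f' fun i => g (σ i)) :=
  (comp (τ := fun _ => Equiv.refl _) h fun _ => refl _).congr fun _ => rfl

theorem assoc {κ : ι → Type} [∀ i, Finite (κ i)]
    {l : (i : ι) → κ i → Type} [∀ i k, Finite (l i k)] {X : (i : ι) → κ i → M.Obj}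
    {Y : (i : ι) → (k : κ i) → l i k → M.Obj}
    (f : M.Hom A B) (g : (i : ι) → M.Hom (X i) (A i))
    (h : (i : ι) → (k : κ i) → M.Hom (Y i k) (X i k)) :
    IsReindexing (Equiv.sigmaAssoc l) (M.comp f (fun i => M.comp (g i) (h i)))
      (M.comp (M.comp f g) (fun p : Σ i, κ i => h p.1 p.2)) :=
  of_eq (M.assoc f g h)

theorem id_comp (f : M.Hom A B) :
    IsReindexing (unitSigma ι) f (M.comp (M.id B) (fun _ : Unit => f)) :=
  of_eq (M.id_comp f)

theorem comp_id (f : M.Hom A B) :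
    IsReindexing (sigmaUnit ι) f (M.comp f (fun i => M.id (A i))) :=
  of_eq (M.comp_id f)

end IsReindexing

end Reindexing

/-! ### Central folds -/

/-- A functor `1_▸ → M` at every object of `M`, such that all arrows of `M` commute with the
arrows in the images of these functors. -/
structure CentralFold (M : SymMulticat.{w}) where
  fold : (A : M.Obj) → (ι : Type) → [Finite ι] → M.Hom (fun _ : ι => A) A
  fold_unit : ∀ A, fold A Unit = M.id A
  fold_sigma : ∀ (A : M.Obj) {ι : Type} [Finite ι] {κ : ι → Type} [∀ i, Finite (κ i)],
    M.comp (fold A ι) (fun i => fold A (κ i)) = fold A (Σ i, κ i)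
  fold_reindex : ∀ (A : M.Obj) {ι κ : Type} [Finite ι] [Finite κ] (σ : κ ≃ ι),
    M.reindex σ (fold A ι) = fold A κ
  central : ∀ {ι : Type} [Finite ι] {A : ι → M.Obj} {B : M.Obj} (f : M.Hom A B)
    (κ : Type) [Finite κ], M.comp f (fun i => fold (A i) κ) =
      M.reindex (sigmaSwap ι κ) (M.comp (fold B κ) (fun _ => f))

namespace CentralFold

variable {M : SymMulticat.{w}} (c : CentralFold M)

theorem isReindexing_fold (A : M.Obj) {ι κ : Type} [Finite ι] [Finite κ] (σ : κ ≃ ι) :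
    IsReindexing σ (c.fold A ι) (c.fold A κ) :=
  .of_eq (c.fold_reindex A σ).symm

theorem isReindexing_central {ι : Type} [Finite ι] {A : ι → M.Obj} {B : M.Obj} (f : M.Hom A B)
    (κ : Type) [Finite κ] : IsReindexing (sigmaSwap ι κ) (M.comp (c.fold B κ) fun _ => f)
      (M.comp f fun i => c.fold (A i) κ) :=
  .of_eq (c.central f κ)

/-- The fold of a family of unary arrows. -/
def glue {ι : Type} [Finite ι] {A : ι → M.Obj} {B : M.Obj}
    (f : ∀ i, M.Hom (fun _ : Unit => A i) B) : M.Hom A B :=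
  M.reindex (sigmaUnit ι).symm (M.comp (c.fold B ι) f)

theorem isReindexing_glue {ι : Type} [Finite ι] {A : ι → M.Obj} {B : M.Obj}
    (f : ∀ i, M.Hom (fun _ : Unit => A i) B) :
    IsReindexing (sigmaUnit ι).symm (M.comp (c.fold B ι) f) (c.glue f) :=
  .reindex _ _

theorem glue_id (A : M.Obj) : c.glue (fun _ : Unit => M.id A) = M.id A := by
  have h := (IsReindexing.comp_id (c.fold A Unit)).trans (c.isReindexing_glue fun _ => M.id A)
  rw [c.fold_unit] at h
  exact (h.eq fun _ => rfl).symm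

/-- Both sides fold the composites `f i (g i k)`. Each unary `f i` can be pulled out of the fold
over `κ i` by centrality, and `fold_sigma` merges the nested folds. -/
theorem glue_comp {ι : Type} [Finite ι] {κ : ι → Type} [∀ i, Finite (κ i)]
    {A : ι → M.Obj} {B : M.Obj} {X : (i : ι) → κ i → M.Obj}
    (f : ∀ i, M.Hom (fun _ : Unit => A i) B) (g : ∀ i k, M.Hom (fun _ : Unit => X i k) (A i)) :
    c.glue (fun p : Σ i, κ i => M.unaryComp (f p.1) (g p.1 p.2)) =
      M.comp (c.glue f) (fun i => c.glue (g i)) := by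
  have h₁ := IsReindexing.assoc (c.fold B ι) (fun i => c.fold B (κ i))
    (fun i k => M.comp (f i) fun _ => g i k)
  rw [c.fold_sigma] at h₁
  have h₂ := (h₁.trans (IsReindexing.comp_right _ fun p : Σ i, κ i =>
    IsReindexing.reindex (unitSigma Unit).symm (M.comp (f p.1) fun _ => g p.1 p.2))).trans
      (c.isReindexing_glue fun p : Σ i, κ i => M.unaryComp (f p.1) (g p.1 p.2))
  have h₃ (i : ι) := ((IsReindexing.assoc (c.fold B (κ i)) (fun _ => f i)
    (fun k _ => g i k)).trans ((c.isReindexing_central (f i) (κ i)).comp_left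
      fun p => g i p.1)).trans
    (IsReindexing.assoc (f i) (fun _ => c.fold (A i) (κ i)) fun _ k => g i k).symm
  have h₄ (i : ι) := (h₃ i).trans
    (IsReindexing.comp_right (f i) fun _ => c.isReindexing_glue (g i))
  have h₅ := ((IsReindexing.comp_right (c.fold B ι) h₄).trans
    (IsReindexing.assoc (c.fold B ι) f fun i _ => c.glue (g i))).trans
      ((c.isReindexing_glue f).comp_left fun p => c.glue (g p.1))
  exact ((h₅.symm.trans h₂).eq fun _ => rfl).symm

theorem glue_reindex {ι κ : Type} [Finite ι] [Finite κ] {A : ι → M.Obj} {B : M.Obj}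
    (σ : κ ≃ ι) (f : ∀ i, M.Hom (fun _ : Unit => A i) B) :
    c.glue (fun k => f (σ k)) = M.reindex σ (c.glue f) :=
  ((c.isReindexing_glue f).symm.trans (((c.isReindexing_fold B σ).comp_left f).trans
    (c.isReindexing_glue fun k => f (σ k)))).eq_reindex fun _ => rfl

/-- The place `i` as the only element of a disjoint union. -/
def place {ι : Type} (i : ι) : Unit ≃ Σ j : ι, PLift (j = i) where
  toFun _ := ⟨i, ⟨rfl⟩⟩
  invFun _ := ()
  left_inv _ := rfl
  right_inv := fun ⟨_, ⟨h⟩⟩ => by subst h; rfl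

/-- The place `i` as the only element of a disjoint union, in the other direction. -/
def coplace {ι : Type} (i : ι) : (Σ j : ι, PLift (i = j)) ≃ Unit where
  toFun _ := ()
  invFun _ := ⟨i, ⟨rfl⟩⟩
  left_inv := fun ⟨_, ⟨h⟩⟩ => by subst h; rfl
  right_inv _ := rfl

/-- The restriction of an arrow to one of its places. -/
def restrict {ι : Type} [Finite ι] {A : ι → M.Obj} {B : M.Obj} (f : M.Hom A B) (i : ι) :
    M.Hom (fun _ : Unit => A i) B :=
  -- `PLift (j = i)` has one element if `j = i` and none otherwise, so up to bijection the fold over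
  -- it is the identity at place `i` and the nullary fold elsewhere; no decision on `j = i` is
  -- needed.
  M.reindex (place i) (M.comp f fun j => c.fold (A j) (PLift (j = i)))

theorem isReindexing_restrict {ι : Type} [Finite ι] {A : ι → M.Obj} {B : M.Obj}
    (f : M.Hom A B) (i : ι) : IsReindexing (place i)
      (M.comp f fun j => c.fold (A j) (PLift (j = i))) (c.restrict f i) :=
  .reindex _ _

/-- Centrality of `f` exchanges the fold of its restrictions for `f` applied, at each place `j`, to
the fold over all `i` of the folds over `j = i`. The latter has a single term and is the identity.
-/
theorem glue_restrict {ι : Type} [Finite ι] {A : ι → M.Obj} {B : M.Obj} (f : M.Hom A B) :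
    c.glue (c.restrict f) = f := by
  have h₁ := (IsReindexing.comp_right (c.fold B ι) fun i => c.isReindexing_restrict f i).trans
    (c.isReindexing_glue (c.restrict f))
  have h₂ := (IsReindexing.assoc (c.fold B ι) (fun _ => f)
    fun i j => c.fold (A j) (PLift (j = i))).trans
    ((c.isReindexing_central f ι).comp_left fun p => c.fold (A p.2) (PLift (p.2 = p.1)))
  have h₃ := IsReindexing.assoc f (X := fun j _ => A j) (fun j => c.fold (A j) ι)
    fun j i => c.fold (A j) (PLift (j = i))
  have h₄ (j : ι) := c.isReindexing_fold (A j) (coplace j)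
  simp only [c.fold_unit] at h₄
  have h₅ := (IsReindexing.comp_id f).trans (IsReindexing.comp_right f h₄)
  simp only [← c.fold_sigma] at h₅
  exact (((h₅.trans h₃).trans (h₂.symm.trans h₁)).eq fun _ => rfl).symm

/-- Centrality of the unary arrows `f j` moves the folds over `j = i` outside them, where
`fold_sigma` merges them into a fold over the singleton `Σ j, PLift (j = i)`, leaving `f i`. -/
theorem restrict_glue {ι : Type} [Finite ι] {A : ι → M.Obj} {B : M.Obj}
    (f : ∀ i, M.Hom (fun _ : Unit => A i) B) (i : ι) : c.restrict (c.glue f) i = f i := by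
  have h₁ := ((c.isReindexing_glue f).comp_left
    fun p => c.fold (A p.1) (PLift (p.1 = i))).trans (c.isReindexing_restrict (c.glue f) i)
  have h₂ := (IsReindexing.assoc (c.fold B ι) f fun j _ => c.fold (A j) (PLift (j = i)))
  have h₃ := IsReindexing.comp_right (c.fold B ι) fun j =>
    c.isReindexing_central (f j) (PLift (j = i))
  have h₄ := IsReindexing.assoc (c.fold B ι) (fun j => c.fold B (PLift (j = i)))
    fun j _ => f j
  rw [c.fold_sigma] at h₄
  have h₅ := ((c.isReindexing_fold B (place i)).comp_left fun p => f p.1)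
  rw [c.fold_unit] at h₅
  have h₆ := (IsReindexing.id_comp (f i)).trans h₅.symm
  exact ((((h₆.trans h₄.symm).trans (h₃.trans h₂)).trans h₁).eq fun _ => rfl).symm

/-- The functor `(M_-)_▸ → M` which folds families of unary arrows. -/
def fromSeq : MFunctor (seq M.Und) M where
  obj A := A.obj
  map f := c.glue f
  map_id A := c.glue_id A.obj
  map_comp f g := c.glue_comp f g
  map_reindex σ f := c.glue_reindex σ f

end CentralFold

/-- A symmetric multicategory with central folds is sequential. -/
theorem isSequential_of_centralFold {M : SymMulticat.{w}} (c : CentralFold M) :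
    IsSequential M := by
  refine ⟨Cat.of M.Und, ⟨?_⟩⟩
  let G : MFunctor M (seq M.Und) :=
    { obj := fun A => ⟨A⟩
      map := fun f => c.restrict f
      -- Restriction inherits functoriality from gluing, of which it is the inverse.
      map_id := fun A => (congrArg c.restrict (c.glue_id A)).symm.trans
        (funext fun i => c.restrict_glue (fun _ => M.id A) i)
      map_comp := fun {ι _ κ _ A B X} f g => by
        have h := c.glue_comp (c.restrict f) fun i => c.restrict (g i)
        simp only [c.glue_restrict] at h
        exact (congrArg c.restrict h).symm.trans (funext (c.restrict_glue _))
      map_reindex := fun σ f => by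
        have h := c.glue_reindex σ (c.restrict f)
        rw [c.glue_restrict] at h
        exact (congrArg c.restrict h).symm.trans (funext (c.restrict_glue _)) }
  let F : MFunctor (seq M.Und) M := c.fromSeq
  exact
    { hom := G
      inv := F
      hom_inv_id := MFunctor.ext (x := (show M ⟶ seq M.Und from G) ≫ F) (y := 𝟙 M) rfl
        (heq_of_eq (by funext ι _ A B f; exact c.glue_restrict f))
      inv_hom_id := MFunctor.ext (x := (show seq M.Und ⟶ M from F) ≫ G) (y := 𝟙 (seq M.Und)) rfl
        (heq_of_eq (by funext ι _ A B f; exact funext (c.restrict_glue f))) }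

theorem IsMultinatural.comp_map {M N : SymMulticat.{w}} {ι : Type} [Finite ι]
    {F : ι → MFunctor M N} {G : MFunctor M N}
    {α : ∀ A : M.Obj, N.Hom (fun i => (F i).obj A) (G.obj A)} (hα : IsMultinatural F G α)
    {κ : Type} [Finite κ] {A : κ → M.Obj} {B : M.Obj} (f : M.Hom A B) :
    N.comp (α B) (fun i => (F i).map f) =
      N.reindex (sigmaSwap ι κ) (N.comp (G.map f) fun k => α (A k)) := by
  have h := IsReindexing.of_eq (σ := sigmaSwap κ ι)
    (f := N.comp (α B) (fun i => (F i).map f)) (hα f)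
  exact h.symm.eq_reindex fun _ => rfl

/-! ### Functors from `1_▸` -/

/-- Arrows of `1_▸` are families in a discrete category, so all equations between parallel arrows
hold. -/
instance {ι : Type} [Finite ι] (A : ι → one.{w}.Obj) (B : one.{w}.Obj) :
    Subsingleton (one.{w}.Hom A B) :=
  ⟨fun _ _ => funext fun _ =>
    Subsingleton.elim (α := Discrete.mk PUnit.unit ⟶ Discrete.mk PUnit.unit) _ _⟩

/-- The unique arrow of `1_▸` of arity `ι`. -/
def one.fold (a : one.{w}.Obj) (ι : Type) [Finite ι] : one.{w}.Hom (fun _ : ι => a) a :=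
  fun _ => 𝟙 (show Discrete PUnit.{w + 1} from a)

theorem one.comp_fold {ι : Type} [Finite ι] {A : ι → one.{w}.Obj} {B : one.{w}.Obj}
    (f : one.Hom A B) (κ : Type) [Finite κ] :
    one.comp f (fun i => one.fold (A i) κ) =
      one.reindex (sigmaSwap ι κ) (one.comp (one.fold B κ) fun _ => f) :=
  Subsingleton.elim _ _

/-- Any two arrows of `1_▸` commute, and `F` preserves this. -/
theorem one.isMultinatural_fold {M : SymMulticat.{w}} (F : MFunctor one M) (ι : Type) [Finite ι] :
    IsMultinatural (fun _ : ι => F) F (fun a => F.map (one.fold a ι)) := by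
  intro κ _ A B f
  exact ((F.map_comp _ _).symm.trans (congrArg F.map (one.comp_fold f ι))).trans
    ((F.map_reindex _ _).trans (congrArg (M.reindex _) (F.map_comp _ _)))

/-! ### Sequentiality of `[1_▸, M]` and of `1_▸ ⊗ M` -/

/-- The central folds of `[1_▸, M]`. -/
def ihom.centralFold (M : SymMulticat.{u + 1}) : CentralFold (ihom one M) where
  fold F ι _ := ⟨fun a => MFunctor.map F (one.fold a ι), one.isMultinatural_fold F ι⟩
  fold_unit F := Subtype.ext (funext fun a => MFunctor.map_id F a)
  fold_sigma F {ι _ _ _} := Subtype.ext (funext fun a =>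
    (MFunctor.map_comp F (one.fold a ι) fun _ => one.fold a _).symm.trans
      (congrArg (MFunctor.map F) (Subsingleton.elim _ _)))
  fold_reindex F {ι _ _ _} σ := Subtype.ext (funext fun a =>
    (MFunctor.map_reindex F σ (one.fold a ι)).symm.trans
      (congrArg (MFunctor.map F) (Subsingleton.elim _ _)))
  -- Multinaturality of `f` with respect to the arrow `one.fold a κ`.
  central f κ _ := Subtype.ext (funext fun a => IsMultinatural.comp_map f.2 (one.fold a κ))

theorem isSequential_ihom_one (M : SymMulticat.{u + 1}) :
    IsSequential ((ihomFunctor one).obj M) :=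
  isSequential_of_centralFold (ihom.centralFold M)

/-- The functor `(-)_X : M → M ⊗ N` for an object `X` of `N`. -/
noncomputable def tensor.leftFunctor (M N : SymMulticat.{u + 1}) (X : N.Obj) :
    MFunctor M (tensor M N) where
  obj A := show M.Obj × N.Obj from (A, X)
  map f := TensorHom.mk (Formal.left f X)
  map_id A := TensorHom.mk_eq (Formal.Rel.left_id A X)
  map_comp f g := (TensorHom.mk_eq (Formal.Rel.left_comp f g X)).trans
    (tensor_comp_mk (Formal.left f X) fun i => Formal.left (g i) X).symm
  map_reindex σ f := (TensorHom.mk_eq (Formal.Rel.left_reindex σ f X)).trans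
    (tensor_reindex_mk σ (Formal.left f X)).symm

/-- The functor from `1_▸` at an object of `1_▸ ⊗ M`. -/
noncomputable def tensor.foldFunctor (M : SymMulticat.{u + 1}) (P : one.{u + 1}.Obj × M.Obj) :
    MFunctor one (tensor one M) where
  obj _ := P
  map {ι _ _ _} _ := (leftFunctor one M P.2).map (one.fold P.1 ι)
  map_id _ := (leftFunctor one M P.2).map_id P.1
  map_comp {ι _ _ _ _ _ _} _ _ := (congrArg (leftFunctor one M P.2).map
    (Subsingleton.elim _ _)).trans
      ((leftFunctor one M P.2).map_comp (one.fold P.1 ι) fun _ => one.fold P.1 _)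
  map_reindex {ι _ _ _ _ _} σ _ := (congrArg (leftFunctor one M P.2).map
    (Subsingleton.elim _ _)).trans ((leftFunctor one M P.2).map_reindex σ (one.fold P.1 ι))

/-- Commuting with the folds is checked on generators and is stable under composition and
reindexing. For `f_X` it holds because all arrows of `1_▸` commute, for `h_A` by the interchange
relation. -/
theorem tensor.isMultinatural (M : SymMulticat.{u + 1}) {ι : Type} [Finite ι]
    {P : ι → one.{u + 1}.Obj × M.Obj} {Q : one.{u + 1}.Obj × M.Obj} (s : Formal one M P Q) :
    IsMultinatural (N := tensor one M) (fun i => foldFunctor M (P i)) (foldFunctor M Q)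
      (fun _ => show TensorHom one M P Q from TensorHom.mk s) := by
  induction s with
  | @left ι _ A B f X =>
    intro κ _ A' B' g
    have h := (leftFunctor one M X).map_comp (one.fold B κ) fun _ => f
    have h' := (leftFunctor one M X).map_comp f fun i => one.fold (A i) κ
    refine h.symm.trans (Eq.trans ?_ (congrArg ((tensor one M).reindex (sigmaSwap κ ι)) h'))
    refine Eq.trans ?_ ((leftFunctor one M X).map_reindex (sigmaSwap κ ι)
      (one.comp f fun i => one.fold (A i) κ))
    exact congrArg (leftFunctor one M X).map (Subsingleton.elim _ _)
  | @right ι _ X Y A h =>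
    intro κ _ A' B' g
    refine (tensor_comp_mk (Formal.left (one.fold A κ) Y) fun i => Formal.right A h).trans ?_
    refine (TensorHom.mk_eq (.interchange (one.fold A κ) h)).trans ?_
    refine (tensor_reindex_mk (sigmaSwap κ ι) _).symm.trans ?_
    exact congrArg ((tensor one M).reindex (sigmaSwap κ ι))
      (tensor_comp_mk (Formal.right A h) fun k => Formal.left (one.fold A κ) (X k)).symm
  | id P => exact isMultinatural_id (foldFunctor M P)
  | comp s t ih₁ ih₂ =>
    rw [← tensor_comp_mk s t]
    exact isMultinatural_comp (N := tensor one M) (F := fun i => foldFunctor M _)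
      (H := fun i j => foldFunctor M _) (G := foldFunctor M _)
      (α := fun _ => TensorHom.mk s) (β := fun i _ => TensorHom.mk (t i)) ih₁ ih₂
  | reindex σ s ih =>
    rw [← tensor_reindex_mk σ s]
    exact isMultinatural_reindex (N := tensor one M) (F := fun i => foldFunctor M _)
      (G := foldFunctor M _) (α := fun _ => TensorHom.mk s) ih σ

/-- The central folds of `1_▸ ⊗ M`. -/
noncomputable def tensor.centralFold (M : SymMulticat.{u + 1}) :
    CentralFold (tensor one M) where
  fold P ι _ := (foldFunctor M P).map (one.fold star ι)
  fold_unit P := (foldFunctor M P).map_id star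
  fold_sigma P {ι _ _ _} :=
    ((foldFunctor M P).map_comp (one.fold star ι) fun _ => one.fold star _).symm
  fold_reindex P {ι _ _ _} σ := ((foldFunctor M P).map_reindex σ (one.fold star ι)).symm
  central f κ _ := by
    revert f
    refine TensorHom.ind fun s => ?_
    exact IsMultinatural.comp_map (N := tensor one M) (F := fun i => foldFunctor M _)
      (G := foldFunctor M _) (α := fun _ => TensorHom.mk s) (isMultinatural M s) (one.fold star κ)

theorem isSequential_tensor_one (M : SymMulticat.{u + 1}) :
    IsSequential ((tensorFunctor one).obj M) :=
  isSequential_of_centralFold (tensor.centralFold M)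

/-! ### Functors into sequential multicategories -/

/-- A functor between discrete cocone multicategories is determined by unary arrows. Place `i` is
isolated by composing `f` with families of identities indexed by `PLift (j = i)`, which leaves the
unary arrow `f i`; the functor preserves this composite. -/
theorem seq.map_apply {C D : Type w} [Category.{w} C] [Category.{w} D]
    (K : MFunctor (seq C) (seq D)) {ι : Type} [Finite ι] {A : ι → C} {B : C}
    (f : ∀ i, A i ⟶ B) (i : ι) :
    K.map (A := A) (B := B) f i = K.map (A := fun _ : Unit => A i) (B := B) (fun _ => f i) () := by
  have h₁ := congrFun (K.map_comp (A := A) (B := B) (X := fun j (_ : PLift (j = i)) => A j) f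
    (fun j _ => 𝟙 (A j))) ⟨i, ⟨rfl⟩⟩
  have h₂ := congrFun (K.map_reindex (CentralFold.place i)
    ((seq C).comp (A := A) (B := B) (X := fun j (_ : PLift (j = i)) => A j) f
    (fun j _ => 𝟙 (A j)))) ()
  have h₃ := congrFun (K.map_reindex (κ := PLift (i = i))
    ⟨fun _ => (), fun _ => ⟨rfl⟩, fun _ => rfl, fun _ => rfl⟩ ((seq C).id (A i))) ⟨rfl⟩
  have h₄ := congrFun (K.map_id (A i)) ()
  have h₅ : K.map (A := fun _ : PLift (i = i) => A i) (B := A i) (fun _ => 𝟙 (A i)) ⟨rfl⟩ =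
      𝟙 (show D from K.obj (A i)) := h₃.trans h₄
  have h₆ : (seq C).reindex (CentralFold.place i)
    ((seq C).comp (A := A) (B := B) (X := fun j (_ : PLift (j = i)) => A j) f
    (fun j _ => 𝟙 (A j))) = (fun _ => f i) := funext fun _ => Category.id_comp (f i)
  rw [h₆] at h₂
  refine Eq.trans ?_ (h₁.symm.trans h₂.symm)
  refine (Category.id_comp (K.map (A := A) (B := B) f i)).symm.trans ?_
  exact congrArg (fun t => t ≫ K.map (A := A) (B := B) f i) h₅.symm

/-- The functor `1_▸ → C_▸` at an object of `C`. -/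
def seq.point {C : Type w} [Category.{w} C] (X : C) : MFunctor one (seq C) where
  obj _ := X
  map _ := fun _ => 𝟙 X
  map_id _ := rfl
  map_comp _ _ := funext fun _ => (Category.comp_id (𝟙 X)).symm
  map_reindex _ _ := rfl

/-- `1_▸` is itself a discrete cocone multicategory, so `seq.map_apply` reduces to the unary case,
where the fold is an identity. -/
theorem seq.map_fold {C : Type w} [Category.{w} C] (F : MFunctor one (seq C)) (a : one.Obj)
    (ι : Type) [Finite ι] : F.map (one.fold a ι) = fun _ => 𝟙 (show C from F.obj a) := by
  funext i
  refine (seq.map_apply (C := Discrete PUnit) F (A := fun _ => a) (B := a)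
    (fun _ => 𝟙 _) i).trans ?_
  exact congrFun (F.map_id a) ()

theorem seq.eq_point {C : Type w} [Category.{w} C] (F : MFunctor one (seq C)) :
    F = seq.point (show C from F.obj star) := by
  refine MFunctor.ext rfl (heq_of_eq ?_)
  funext ι _ A B f
  exact (congrArg F.map (Subsingleton.elim f (one.fold star ι))).trans (seq.map_fold F star ι)

/-- The source of uniqueness in both universal properties: a sequential multicategory leaves no
choice of folds at an object. -/
theorem one_hom_ext {S : SymMulticat.{w}} (hS : IsSequential S) {F G : one ⟶ S}
    (h : MFunctor.obj F star = MFunctor.obj G star) : F = G := by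
  obtain ⟨C, ⟨e⟩⟩ := hS
  rw [← cancel_mono e.hom]
  have h₁ := seq.eq_point (C := C) (F ≫ e.hom)
  have h₂ := seq.eq_point (C := C) (G ≫ e.hom)
  refine h₁.trans (Eq.trans ?_ h₂.symm)
  exact congrArg (fun X => seq.point (C := C) (MFunctor.obj e.hom X)) h

/-! ### The universal property of `1_▸ ⊗ M` -/

section TensorLift

variable {M : SymMulticat.{u + 1}} {C : Type (u + 1)} [Category.{u + 1} C]

/-- The extension of a functor `M → C_▸` to formal arrows of `1_▸ ⊗ M`. -/
noncomputable def Formal.lift (G : MFunctor M (seq C)) {ι : Type} [Finite ι]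
    {P : ι → one.{u + 1}.Obj × M.Obj} {Q : one.{u + 1}.Obj × M.Obj} (s : Formal one M P Q) :
    (seq C).Hom (fun i => G.obj (P i).2) (G.obj Q.2) :=
  Formal.rec
    (motive := fun {_} _ P Q _ => (seq C).Hom (fun i => G.obj (P i).2) (G.obj Q.2))
    -- The only possible value, by `seq.map_fold`.
    (fun _ X _ => 𝟙 (show C from G.obj X))
    (fun _ h => G.map h)
    (fun P => (seq C).id (G.obj P.2))
    (fun _ _ s t => (seq C).comp s t)
    (fun σ _ s => (seq C).reindex σ s)
    s

/-- In the interchange relation the generators from `1_▸` become identities, so both sides reduce to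
the components of `G.map h`. -/
theorem Formal.lift_rel (G : MFunctor M (seq C)) {ι : Type} [Finite ι]
    {P : ι → one.{u + 1}.Obj × M.Obj} {Q : one.{u + 1}.Obj × M.Obj} {s t : Formal one M P Q}
    (h : Formal.Rel one M s t) : Formal.lift G s = Formal.lift G t := by
  induction h with
  | refl s => rfl
  | symm _ ih => exact ih.symm
  | trans _ _ ih₁ ih₂ => exact ih₁.trans ih₂
  | comp_congr _ _ ih₁ ih₂ => exact congrArg₂ (seq C).comp ih₁ (funext ih₂)
  | reindex_congr σ _ ih => exact congrArg ((seq C).reindex σ) ih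
  | id_comp s => exact (seq C).id_comp _
  | comp_id s => exact (seq C).comp_id _
  | assoc s t r =>
    exact (seq C).assoc (Formal.lift G s) (fun i => Formal.lift G (t i))
      (fun i k => Formal.lift G (r i k))
  | reindex_refl s => rfl
  | reindex_trans σ τ s => rfl
  | comp_reindex_right s t σ => rfl
  | comp_reindex_left s t σ => rfl
  | left_id A X => rfl
  | left_comp f g X => exact funext fun _ => (Category.comp_id _).symm
  | left_reindex σ f X => rfl
  | right_id A X => exact G.map_id X
  | right_comp A h k => exact G.map_comp h k
  | right_reindex A σ h => exact G.map_reindex σ h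
  | interchange f h =>
    exact funext fun p => (Category.comp_id (G.map h p.2)).trans
      (Category.id_comp (G.map h p.2)).symm

/-- The extension of a functor `M → C_▸` to `1_▸ ⊗ M`. -/
noncomputable def tensor.lift (G : MFunctor M (seq C)) : MFunctor (tensor one M) (seq C) where
  obj (P : one.Obj × M.Obj) := G.obj P.2
  map s := Formal.lift G (TensorHom.rep s)
  map_id P := Formal.lift_rel G (TensorHom.rep_mk (Formal.id P))
  map_comp _ _ := Formal.lift_rel G (TensorHom.rep_mk _)
  map_reindex _ _ := Formal.lift_rel G (TensorHom.rep_mk _)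

theorem tensor.lift_map_mk (G : MFunctor M (seq C)) {ι : Type} [Finite ι]
    {P : ι → one.{u + 1}.Obj × M.Obj} {Q : one.{u + 1}.Obj × M.Obj} (s : Formal one M P Q) :
    (tensor.lift G).map (A := P) (B := Q) (TensorHom.mk s) = Formal.lift G s :=
  Formal.lift_rel G (TensorHom.rep_mk s)

theorem insertion_lift (G : M ⟶ seq C) :
    insertion M ≫ (show tensor one M ⟶ seq C from tensor.lift G) = G := by
  refine MFunctor.ext (x := insertion M ≫ (show tensor one M ⟶ seq C from tensor.lift G))
    (y := G) rfl (heq_of_eq ?_)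
  funext ι _ A B h
  exact tensor.lift_map_mk G (Formal.right star h)

/-- Induction on formal arrows: on `h_A` the functors agree by construction, and on `f_X` any
functor into `C_▸` gives identities. -/
theorem lift_insertion (K : tensor one M ⟶ seq C) :
    tensor.lift (insertion M ≫ K) = K := by
  refine MFunctor.ext (x := tensor.lift (insertion M ≫ K)) (y := K) rfl (heq_of_eq ?_)
  funext ι _ P Q s
  revert s
  refine TensorHom.ind fun s => (tensor.lift_map_mk (insertion M ≫ K) s).trans ?_
  let K' : MFunctor (tensor one M) (seq C) := K
  change Formal.lift (insertion M ≫ K) s = K'.map (TensorHom.mk s)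
  induction s with
  | @left ι _ A B f X =>
    let F : MFunctor one (seq C) := (show one ⟶ tensor one M from tensor.leftFunctor one M X) ≫ K
    exact ((congrArg F.map (Subsingleton.elim f (one.fold star ι))).trans
      (seq.map_fold F star ι)).symm
  | right A h => rfl
  | id P => exact (K'.map_id P).symm
  | comp s t ih₁ ih₂ =>
    rw [← tensor_comp_mk s t]
    exact (congrArg₂ (seq C).comp ih₁ (funext ih₂)).trans
      (K'.map_comp (TensorHom.mk s) fun i => TensorHom.mk (t i)).symm
  | reindex σ s ih =>
    rw [← tensor_reindex_mk σ s]
    exact (congrArg ((seq C).reindex σ) ih).trans (K'.map_reindex σ (TensorHom.mk s)).symm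

end TensorLift

theorem insertion_bijective (M : SymMulticat.{u + 1}) {S : SymMulticat.{u + 1}}
    (hS : IsSequential S) :
    Function.Bijective fun K : (tensorFunctor one).obj M ⟶ S => insertion M ≫ K := by
  obtain ⟨C, ⟨e⟩⟩ := hS
  constructor
  · intro K L h
    have h' : insertion M ≫ (K ≫ e.hom) = insertion M ≫ (L ≫ e.hom) := by
      simp only [← Category.assoc]
      exact congrArg (· ≫ e.hom) h
    rw [← cancel_mono e.hom]
    exact (lift_insertion (C := C) (K ≫ e.hom)).symm.trans
      ((congrArg (fun G : M ⟶ seq C => tensor.lift (C := C) G) h').trans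
        (lift_insertion (C := C) (L ≫ e.hom)))
  · intro G
    refine ⟨(show tensor one M ⟶ seq C from tensor.lift (C := C) (G ≫ e.hom)) ≫ e.inv, ?_⟩
    have h := insertion_lift (C := C) (G ≫ e.hom)
    exact (Category.assoc _ _ _).symm.trans ((congrArg (· ≫ e.inv) h).trans
      ((Category.assoc G e.hom e.inv).trans
        ((congrArg (G ≫ ·) e.hom_inv_id).trans (Category.comp_id G))))

/-! ### The universal property of `[1_▸, M]` -/

theorem ihom_functor_ext {S M N : SymMulticat.{u + 1}} {K L : MFunctor S (ihom M N)}
    (h : ∀ A, K.obj A = L.obj A)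
    (h' : ∀ {ι : Type} [Finite ι] {A : ι → S.Obj} {B : S.Obj} (f : S.Hom A B) (X : M.Obj),
      HEq ((K.map f).1 X) ((L.map f).1 X)) : K = L := by
  obtain ⟨o, m, _, _, _⟩ := K
  obtain ⟨o', m', _, _, _⟩ := L
  obtain rfl : o = o' := funext h
  refine MFunctor.ext rfl (heq_of_eq ?_)
  funext ι _ A B f
  exact Subtype.ext (funext fun X => eq_of_heq (h' f X))

/-- The functor `1_▸ → [1_▸, M]` at an object of `[1_▸, M]`. -/
def ihom.foldFunctor {M : SymMulticat.{u + 1}} (F : MFunctor one M) :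
    MFunctor one (ihom one M) where
  obj _ := F
  map {ι _ _ _} _ := (centralFold M).fold F ι
  map_id _ := (centralFold M).fold_unit F
  map_comp _ _ := ((centralFold M).fold_sigma F).symm
  map_reindex σ _ := ((centralFold M).fold_reindex F σ).symm

section Coinduce

variable {M : SymMulticat.{u + 1}} {C : Type (u + 1)} [Category.{u + 1} C]

/-- The functor `C_▸ → [1_▸, M]` corresponding to a functor `C_▸ → M`. -/
def ihom.coinduce (G : seq C ⟶ M) : MFunctor (seq C) (ihom one M) where
  obj A := (show one ⟶ seq C from seq.point (C := C) A) ≫ G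
  -- Multinaturality: both sides are images under `G` of the array with entries `f p.2`, composed
  -- with an identity on one side or on the other.
  map {ι _ A B} f := ⟨fun _ => MFunctor.map G f, fun {κ} _ _ _ _ =>
    (MFunctor.map_comp G (A := fun _ : κ => B) (B := B) (X := fun _ => A)
      (fun _ : κ => 𝟙 (show C from B)) fun _ => f).symm.trans
    ((congrArg (MFunctor.map G) (funext fun p =>
      (Category.comp_id (f p.2)).trans (Category.id_comp (f p.2)).symm)).trans
    ((MFunctor.map_reindex G (sigmaSwap κ ι) _).trans (congrArg (M.reindex (sigmaSwap κ ι))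
      (MFunctor.map_comp G (A := A) (B := B) (X := fun i (_ : κ) => A i) f
        fun i _ => 𝟙 (show C from A i)))))⟩
  map_id A := Subtype.ext (funext fun _ => MFunctor.map_id G A)
  map_comp f g := Subtype.ext (funext fun _ => MFunctor.map_comp G f g)
  map_reindex σ f := Subtype.ext (funext fun _ => MFunctor.map_reindex G σ f)

/-- The arrows agree by definition, as `1_▸` has one object. On objects this is Eckmann–Hilton: the
folds at `K A` transported from `C_▸` coincide with the pointwise folds, because `[1_▸, M]` is
sequential. -/
theorem evaluation_coinduce (K : seq C ⟶ (ihomFunctor one).obj M) :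
    ihom.coinduce (K ≫ evaluation M) = K := by
  let K' : MFunctor (seq C) (ihom one M) := K
  refine ihom_functor_ext (L := K') (fun A => ?_) fun f a => HEq.rfl
  refine MFunctor.ext rfl (heq_of_eq ?_)
  funext ι _ a b f
  have h : (show one ⟶ seq C from seq.point (C := C) A) ≫ K =
      (show one ⟶ (ihomFunctor one).obj M from ihom.foldFunctor (K'.obj A)) :=
    one_hom_ext (isSequential_ihom_one M) rfl
  have h' : K'.map ((seq.point (C := C) A).map (one.fold star ι)) =
      (ihom.foldFunctor (K'.obj A)).map (one.fold star ι) :=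
    eq_of_heq (congr_arg_heq (fun F : MFunctor one (ihom one M) => F.map (one.fold star ι)) h)
  exact (congrFun (congrArg Subtype.val h') star).trans
    (congrArg (K'.obj A).map (Subsingleton.elim _ _))

end Coinduce

theorem evaluation_bijective (M : SymMulticat.{u + 1}) {S : SymMulticat.{u + 1}}
    (hS : IsSequential S) :
    Function.Bijective fun K : S ⟶ (ihomFunctor one).obj M => K ≫ evaluation M := by
  obtain ⟨C, ⟨e⟩⟩ := hS
  constructor
  · intro K L h
    have h' : (e.inv ≫ K) ≫ evaluation M = (e.inv ≫ L) ≫ evaluation M := by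
      simp only [Category.assoc]
      exact congrArg (e.inv ≫ ·) h
    rw [← cancel_epi e.inv]
    exact (evaluation_coinduce (C := C) (e.inv ≫ K)).symm.trans
      ((congrArg (fun G : seq C ⟶ M => ihom.coinduce (C := C) G) h').trans
        (evaluation_coinduce (C := C) (e.inv ≫ L)))
  · intro G
    -- Evaluating `ihom.coinduce G` gives back `G` by definition.
    exact ⟨e.hom ≫ (show seq C ⟶ (ihomFunctor one).obj M from
      ihom.coinduce (C := C) (e.inv ≫ G)), e.hom_inv_id_assoc G⟩

/-! ### Sequential multicategories and categories -/

/-- `(-)_▸` is fully faithful. -/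
def seqFunctor_fullyFaithful : seqFunctor.{w}.FullyFaithful where
  preimage {C D} K := Functor.toCatHom (C := C) (D := D)
    { obj := fun A => MFunctor.obj K A
      map := fun {A B} f => MFunctor.map (M := seq C) (N := seq D) K
        (A := fun _ : Unit => A) (B := B) (fun _ => f) ()
      map_id := fun A => congrFun (MFunctor.map_id K A) ()
      -- Composites in `C_▸` are indexed by `Σ _ : Unit, Unit`; `seq.map_apply` returns to the index
      -- set `Unit`.
      map_comp := fun {A B E} f g =>
        (seq.map_apply (C := C) (D := D) K (A := fun _ : Σ _ : Unit, Unit => A) (B := E)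
          (fun _ => f ≫ g) ⟨(), ()⟩).symm.trans
        (congrFun (MFunctor.map_comp (M := seq C) (N := seq D) K (A := fun _ : Unit => B) (B := E)
          (X := fun _ (_ : Unit) => A) (fun _ => g) fun _ _ => f) ⟨(), ()⟩) }
  map_preimage {C D} K := by
    refine MFunctor.ext (M := seq C) (N := seq D) rfl (heq_of_eq ?_)
    funext ι _ A B f
    exact funext fun i => (seq.map_apply (C := C) (D := D) K f i).symm
  preimage_map {C D} F := rfl

/-- The functor `(-)_▸` into the sequential multicategories. -/
def seqLift : Cat.{w, w} ⥤ IsSequential.{w}.FullSubcategory :=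
  IsSequential.lift seqFunctor fun C => ⟨C, ⟨Iso.refl _⟩⟩

instance : seqLift.{w}.IsEquivalence where
  faithful := by
    have := seqFunctor_fullyFaithful.{w}.faithful
    exact Functor.Faithful.of_comp_iso
      (show seqLift ⋙ IsSequential.ι ≅ seqFunctor.{w} from Iso.refl _)
  full := by
    have := seqFunctor_fullyFaithful.{w}.full
    exact Functor.Full.of_comp_faithful_iso
      (show seqLift ⋙ IsSequential.ι ≅ seqFunctor.{w} from Iso.refl _)
  essSurj := ⟨fun S => by
    obtain ⟨C, ⟨e⟩⟩ := S.property
    exact ⟨C, ⟨IsSequential.isoMk e.symm⟩⟩⟩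

/-! ### The adjunctions -/

theorem insertion_naturality {M N : SymMulticat.{u + 1}} (K : M ⟶ N) :
    K ≫ insertion N = insertion M ≫ (tensorFunctor one).map K := by
  refine MFunctor.ext (x := K ≫ insertion N) (y := insertion M ≫ (tensorFunctor one).map K) rfl
    (heq_of_eq ?_)
  funext ι _ A B h
  exact (TensorHom.mk_eq (Formal.map_rel one K (TensorHom.rep_mk (Formal.right star h)))).symm

/-- Restriction along the canonical functor `M → 1_▸ ⊗ M`. -/
noncomputable def insertionEquiv (M : SymMulticat.{u + 1})
    (S : IsSequential.{u + 1}.FullSubcategory) :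
    ((IsSequential.lift (tensorFunctor.{u} one) isSequential_tensor_one).obj M ⟶ S) ≃
      (M ⟶ S.obj) :=
  (ObjectProperty.fullyFaithfulι _).homEquiv.trans
    (Equiv.ofBijective (fun K => insertion M ≫ K) (insertion_bijective M S.property))

/-- Composition with the canonical functor `[1_▸, M] → M`. -/
noncomputable def evaluationEquiv (M : SymMulticat.{u + 1})
    (S : IsSequential.{u + 1}.FullSubcategory) :
    (S ⟶ (IsSequential.lift (ihomFunctor.{u} one) isSequential_ihom_one).obj M) ≃
      (S.obj ⟶ M) :=
  (ObjectProperty.fullyFaithfulι _).homEquiv.trans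
    (Equiv.ofBijective (fun K => K ≫ evaluation M) (evaluation_bijective M S.property))

/-- `1_▸ ⊗ -` is left adjoint to the inclusion of the sequential multicategories. -/
noncomputable def tensorAdjunction :
    IsSequential.lift (tensorFunctor.{u} one) isSequential_tensor_one ⊣ IsSequential.ι :=
  Adjunction.mkOfHomEquiv
    { homEquiv := fun M S => insertionEquiv M S
      homEquiv_naturality_left_symm := fun {M' M S} f g => by
        rw [Equiv.symm_apply_eq]
        obtain ⟨g, rfl⟩ := (insertionEquiv M S).surjective g
        rw [Equiv.symm_apply_apply]
        exact (Category.assoc _ _ _).symm.trans ((congrArg (· ≫ g.hom)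
          (insertion_naturality f)).trans (Category.assoc _ _ _))
      homEquiv_naturality_right := fun {M S S'} f g => (Category.assoc (insertion M) _ _).symm }

theorem tensorAdjunction_unit_app (M : SymMulticat.{u + 1}) :
    tensorAdjunction.unit.app M = insertion M :=
  (Adjunction.homEquiv_id tensorAdjunction M).symm.trans (by
    rw [tensorAdjunction, Adjunction.mkOfHomEquiv_homEquiv]
    exact Category.comp_id (insertion M))

/-- `[1_▸, -]` is right adjoint to the inclusion of the sequential multicategories. -/
noncomputable def ihomAdjunction :
    IsSequential.ι ⊣ IsSequential.lift (ihomFunctor.{u} one) isSequential_ihom_one :=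
  Adjunction.mkOfHomEquiv
    { homEquiv := fun S M => (evaluationEquiv M S).symm
      homEquiv_naturality_left_symm := fun {_ _ M} f g =>
        Category.assoc f.hom g.hom (evaluation M)
      homEquiv_naturality_right := fun {S M M'} f g => by
        rw [Equiv.symm_apply_eq]
        obtain ⟨f, rfl⟩ := (evaluationEquiv M S).surjective f
        rw [Equiv.symm_apply_apply]
        exact (Category.assoc f.hom ((ihomFunctor one).map g) (evaluation M')).trans
          (Category.assoc f.hom (evaluation M) g).symm }

theorem ihomAdjunction_counit_app (M : SymMulticat.{u + 1}) :
    ihomAdjunction.counit.app M = evaluation M :=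
  (Adjunction.homEquiv_symm_id ihomAdjunction M).symm.trans (by
    rw [ihomAdjunction, Adjunction.mkOfHomEquiv_homEquiv]
    exact Category.id_comp (evaluation M))

/-- A category is the underlying category of its image under `(-)_▸`. -/
def seqUndIso : seqLift.{w} ⋙ IsSequential.ι ⋙ und ≅ 𝟭 _ :=
  NatIso.ofComponents fun C =>
    { hom := Functor.toCatHom (C := (seq C).Und) (D := C)
        { obj := fun A => A.obj
          map := fun f => f ()
          map_id := fun _ => rfl
          map_comp := fun _ _ => rfl }
      inv := Functor.toCatHom (C := C) (D := (seq C).Und)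
        { obj := fun A => ⟨A⟩
          map := fun f _ => f
          map_id := fun _ => rfl
          map_comp := fun _ _ => rfl }
      hom_inv_id := rfl
      inv_hom_id := rfl }

/-- The inverse of the equivalence of categories with sequential multicategories takes
underlying categories. -/
noncomputable def undIsoInverse : IsSequential.ι ⋙ und.{w} ≅ seqLift.inv :=
  (seqLift.asEquivalence.invFunIdAssoc (IsSequential.ι ⋙ und)).symm ≪≫
    Functor.isoWhiskerLeft seqLift.inv seqUndIso ≪≫ Functor.rightUnitor _

/-- `(1_▸ ⊗ -)_-` is left adjoint to `(-)_▸`. -/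
noncomputable def tensorUndAdjunction : tensorFunctor.{u} one ⋙ und ⊣ seqFunctor :=
  -- `seqLift` followed by the inclusion is `seqFunctor` by definition; the inverse equivalence is
  -- then exchanged for the underlying category.
  (tensorAdjunction.comp seqLift.asEquivalence.symm.toAdjunction).ofNatIsoLeft
    (Functor.isoWhiskerLeft (IsSequential.lift (tensorFunctor.{u} one) isSequential_tensor_one)
      undIsoInverse.symm)

/-- `(-)_▸` is left adjoint to `[1_▸, -]_-`. -/
noncomputable def seqAdjunction : seqFunctor ⊣ ihomFunctor.{u} one ⋙ und :=
  (seqLift.asEquivalence.toAdjunction.comp ihomAdjunction).ofNatIsoRight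
    (Functor.isoWhiskerLeft (IsSequential.lift (ihomFunctor.{u} one) isSequential_ihom_one)
      undIsoInverse.symm)

/-! ### Iterated multiplication in a commutative monoid -/

/-- Adding a point to `α` is a sum indexed by `Bool`, so the arities of the unit, the identity and
the multiplication generate all finite sets under disjoint unions and bijections. -/
theorem finite_induction {P : (ι : Type) → [Finite ι] → Prop} (empty : P Empty) (unit : P Unit)
    (bool : P Bool)
    (sigma : ∀ {ι : Type} [Finite ι] {κ : ι → Type} [∀ i, Finite (κ i)], P ι → (∀ i, P (κ i)) →
      P (Σ i, κ i))
    (equiv : ∀ {ι κ : Type} [Finite ι] [Finite κ], (κ ≃ ι) → P ι → P κ)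
    (ι : Type) [h : Finite ι] : P ι := by
  refine Finite.induction_empty_option (P := fun ι => ∀ [Finite ι], P ι) ?_ ?_ ?_ ι
  · intro α β e hα _
    have := Finite.of_equiv β e.symm
    exact equiv e.symm hα
  · exact equiv (Equiv.equivOfIsEmpty _ _) empty
  · intro α _ hα _
    have h : P (Σ b : Bool, bif b then Unit else α) :=
      sigma (κ := fun b => bif b then Unit else α) bool fun b =>
        match b with
        | false => hα
        | true => unit
    exact equiv ((Equiv.optionEquivSumPUnit α).trans (Equiv.sumEquivSigmaBool α Unit)) h

section

variable {M : SymMulticat.{w}} {X : M.Obj}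

/-- `L false ⊕ L true ≃ Σ b, L b`. -/
def sumSigmaBool (L : Bool → Type) : L false ⊕ L true ≃ Σ b, L b where
  toFun := Sum.elim (fun x => ⟨false, x⟩) (fun x => ⟨true, x⟩)
  invFun p := match p with
    | ⟨false, x⟩ => Sum.inl x
    | ⟨true, x⟩ => Sum.inr x
  left_inv p := by cases p <;> rfl
  right_inv p := by rcases p with ⟨_ | _, _⟩ <;> rfl

theorem isReindexing_comp₂ (m : M.Hom (fun _ : Bool => X) X) {L : Bool → Type}
    [∀ b, Finite (L b)] (h : ∀ b, M.Hom (fun _ : L b => X) X) :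
    IsReindexing (sumSigmaBool L) (M.comp m h) (M.comp₂ m (h false) (h true)) := by
  -- The two index types agree only after case distinction on `b`, hence bijections that are
  -- identities case by case.
  let τ : ∀ b, (bif b then L true else L false) ≃ L b := fun b =>
    match b with
    | false => Equiv.refl _
    | true => Equiv.refl _
  refine ((IsReindexing.comp_right (τ := τ) m fun b => ?_).trans (.reindex _ _)).congr ?_
  · cases b
    · exact .refl _
    · exact .refl _
  · rintro (x | x) <;> rfl

theorem isReindexing_comp₂_congr (m : M.Hom (fun _ : Bool => X) X) {ι κ ι' κ' : Type} [Finite ι]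
    [Finite κ] [Finite ι'] [Finite κ'] {f : M.Hom (fun _ : ι => X) X}
    {g : M.Hom (fun _ : κ => X) X} {f' : M.Hom (fun _ : ι' => X) X}
    {g' : M.Hom (fun _ : κ' => X) X} {σ : ι' ≃ ι} {τ : κ' ≃ κ}
    (hf : IsReindexing σ f f') (hg : IsReindexing τ g g') :
    IsReindexing (Equiv.sumCongr σ τ) (M.comp₂ m f g) (M.comp₂ m f' g') := by
  let ρ : ∀ b, (bif b then κ' else ι') ≃ (bif b then κ else ι) := fun b =>
    match b with
    | false => σ
    | true => τ
  refine (((IsReindexing.reindex _ _).symm.trans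
    (IsReindexing.comp_right (τ := ρ) m fun b => ?_)).trans (.reindex _ _)).congr ?_
  · cases b
    · exact hf
    · exact hg
  · rintro (x | x) <;> rfl

/-- Associativity of substitution for `m(f, g)`; it allows operations to be substituted for the
variables in the monoid axioms. -/
theorem isReindexing_comp₂_comp (m : M.Hom (fun _ : Bool => X) X) {ι κ : Type} [Finite ι]
    [Finite κ] (f : M.Hom (fun _ : ι => X) X) (g : M.Hom (fun _ : κ => X) X)
    {L : ι ⊕ κ → Type} [∀ p, Finite (L p)] (h : ∀ p, M.Hom (fun _ : L p => X) X) :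
    IsReindexing (Equiv.sumSigmaDistrib L)
      (M.comp₂ m (M.comp f fun i => h (Sum.inl i)) (M.comp g fun k => h (Sum.inr k)))
      (M.comp (M.comp₂ m f g) h) := by
  let k : ∀ b, M.Hom (fun _ : (bif b then κ else ι) => X) X := fun b =>
    match b with
    | false => f
    | true => g
  let L' : ∀ b, (bif b then κ else ι) → Type := fun b =>
    match b with
    | false => fun i => L (Sum.inl i)
    | true => fun i => L (Sum.inr i)
  have : ∀ b i, Finite (L' b i) := fun b =>
    match b with
    | false => fun i => inferInstanceAs (Finite (L (Sum.inl i)))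
    | true => fun i => inferInstanceAs (Finite (L (Sum.inr i)))
  let h' : ∀ b i, M.Hom (fun _ : L' b i => X) X := fun b =>
    match b with
    | false => fun i => h (Sum.inl i)
    | true => fun i => h (Sum.inr i)
  let τ : ∀ p, L p ≃ L' (sumSigmaBool (fun b => bif b then κ else ι) p).1
      (sumSigmaBool (fun b => bif b then κ else ι) p).2 := fun p =>
    match p with
    | Sum.inl _ => Equiv.refl _
    | Sum.inr _ => Equiv.refl _
  have h₁ := isReindexing_comp₂ m fun b => M.comp (k b) (h' b)
  have h₂ := IsReindexing.assoc m k h'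
  have h₃ := (isReindexing_comp₂ m k).comp (g := fun p => h' p.1 p.2) (g' := h) (τ := τ)
    fun p => by
      cases p
      · exact .refl _
      · exact .refl _
  exact ((h₁.symm.trans h₂).trans h₃).congr fun p => by rcases p with ⟨x | x, y⟩ <;> rfl

theorem isReindexing_comp_of_isEmpty {ι : Type} [Finite ι] [IsEmpty ι] {A : ι → M.Obj}
    {B : M.Obj} (f : M.Hom A B) {L : ι → Type} [∀ i, Finite (L i)]
    {Y : (i : ι) → L i → M.Obj} (h : ∀ i, M.Hom (Y i) (A i)) :
    IsReindexing (Equiv.equivOfIsEmpty _ _) f (M.comp f h) :=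
  ((IsReindexing.comp_id f).trans
    (IsReindexing.comp_right (τ := isEmptyElim) f isEmptyElim)).congr isEmptyElim

/-! ### The monoid laws for operations in place of variables -/

namespace CMonoid

variable (A : CMonoid M)

theorem isReindexing_mul_comm {ι κ : Type} [Finite ι] [Finite κ]
    (f : M.Hom (fun _ : ι => A.X) A.X) (g : M.Hom (fun _ : κ => A.X) A.X) :
    IsReindexing (Equiv.sumComm κ ι) (M.comp₂ A.mul f g) (M.comp₂ A.mul g f) := by
  let h : ∀ b, M.Hom (fun _ : (bif b then κ else ι) => A.X) A.X := fun b =>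
    match b with
    | false => f
    | true => g
  have h₁ := IsReindexing.reindex Equiv.boolNot A.mul
  rw [A.mul_comm] at h₁
  exact (((isReindexing_comp₂ A.mul h).symm.trans (h₁.comp_left h)).trans
    (isReindexing_comp₂ A.mul fun b => h (Equiv.boolNot b))).congr
      fun p => by rcases p with x | x <;> rfl

theorem isReindexing_unit_mul {ι : Type} [Finite ι] (f : M.Hom (fun _ : ι => A.X) A.X) :
    IsReindexing (Equiv.emptySum Empty ι) f (M.comp₂ A.mul A.unit f) := by
  have h₁ := (IsReindexing.of_eq A.unit_mul).comp_left fun _ => f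
  have h₂ := isReindexing_comp₂_comp A.mul A.unit (M.id A.X) fun _ => f
  have h₃ := isReindexing_comp₂_congr A.mul
    (isReindexing_comp_of_isEmpty A.unit fun _ => f).symm (IsReindexing.id_comp f).symm
  exact ((((IsReindexing.id_comp f).trans h₁).trans h₂.symm).trans h₃).congr
    fun p => by rcases p with ⟨⟨⟩⟩ | x; rfl

theorem isReindexing_mul_assoc {ι κ l : Type} [Finite ι] [Finite κ] [Finite l]
    (f : M.Hom (fun _ : ι => A.X) A.X) (g : M.Hom (fun _ : κ => A.X) A.X)
    (h : M.Hom (fun _ : l => A.X) A.X) :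
    IsReindexing (Equiv.sumAssoc ι κ l) (M.comp₂ A.mul f (M.comp₂ A.mul g h))
      (M.comp₂ A.mul (M.comp₂ A.mul f g) h) := by
  let L : Unit ⊕ Bool → Type := Sum.elim (fun _ => ι) fun b => bif b then l else κ
  have : ∀ p, Finite (L p) := fun p =>
    match p with
    | Sum.inl _ => inferInstanceAs (Finite ι)
    | Sum.inr false => inferInstanceAs (Finite κ)
    | Sum.inr true => inferInstanceAs (Finite l)
  let k : ∀ p, M.Hom (fun _ : L p => A.X) A.X := fun p =>
    match p with
    | Sum.inl _ => f
    | Sum.inr false => g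
    | Sum.inr true => h
  have h₁ := (IsReindexing.of_eq A.mul_assoc).comp_left k
  have h₂ := isReindexing_comp₂_comp A.mul (M.id A.X) A.mul k
  let σ := ((Equiv.boolEquivPUnitSumPUnit.sumCongr (Equiv.refl Unit)).trans
      (Equiv.sumAssoc Unit Unit Unit)).trans
      ((Equiv.refl Unit).sumCongr Equiv.boolEquivPUnitSumPUnit.symm)
  have h₃ := isReindexing_comp₂_comp A.mul A.mul (M.id A.X) fun p => k (σ p)
  have h₄ := isReindexing_comp₂_congr A.mul (IsReindexing.id_comp f).symm
    (isReindexing_comp₂ A.mul fun b => k (Sum.inr b))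
  have h₅ := isReindexing_comp₂_congr A.mul
    (isReindexing_comp₂ A.mul fun b => k (σ (Sum.inl b))) (IsReindexing.id_comp h).symm
  exact ((((h₄.symm.trans h₂).trans h₁).trans h₃.symm).trans h₅).congr
    fun p => by rcases p with (x | x) | x <;> rfl

end CMonoid
end

/-! ### Labelled operations and the characterisation of iterated multiplication -/

namespace CMonoid

variable {M : SymMulticat.{w}} (A : CMonoid M)

/-- An operation on a commutative monoid, with places labelled by elements of `V`. -/
structure Labelled (V : Type) : Type (max 1 w) where
  ι : Type
  finite : Finite ι
  label : ι → V
  op : M.Hom (fun _ : ι => A.X) A.X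

attribute [instance] Labelled.finite

namespace Labelled

variable {A} {V : Type}

instance setoid : Setoid (A.Labelled V) where
  r s t := ∃ σ : t.ι ≃ s.ι, (∀ k, s.label (σ k) = t.label k) ∧ IsReindexing σ s.op t.op
  iseqv :=
    { refl := fun s => ⟨Equiv.refl _, fun _ => rfl, .refl _⟩
      symm := fun {s t} ⟨σ, h, h'⟩ => ⟨σ.symm, fun k => by
        rw [← h, Equiv.apply_symm_apply], h'.symm⟩
      trans := fun {s t r} ⟨σ, h, h'⟩ ⟨τ, k, k'⟩ => ⟨τ.trans σ, fun x =>
        (h (τ x)).trans (k x), h'.trans k'⟩ }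

/-- The labelled operation `m(s, t)`. -/
def mul (s t : A.Labelled V) : A.Labelled V where
  ι := s.ι ⊕ t.ι
  finite := inferInstance
  label := Sum.elim s.label t.label
  op := M.comp₂ A.mul s.op t.op

/-- The unit as a labelled operation. -/
def one : A.Labelled V where
  ι := Empty
  finite := inferInstance
  label := Empty.elim
  op := A.unit

/-- The labelled operation `f(s₁, …, sₙ)`. -/
def subst {ι : Type} [Finite ι] (f : M.Hom (fun _ : ι => A.X) A.X) (s : ι → A.Labelled V) :
    A.Labelled V where
  ι := Σ i, (s i).ι
  finite := inferInstance
  label p := (s p.1).label p.2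
  op := M.comp f fun i => (s i).op

/-- The identity with its place labelled by `v`. -/
def var (v : V) : A.Labelled V where
  ι := Unit
  finite := inferInstance
  label _ := v
  op := M.id A.X

end Labelled

/-- Labelled operations up to bijections which preserve the labels. -/
def LabelledClass (V : Type) : Type (max 1 w) :=
  Quotient (Labelled.setoid (A := A) (V := V))

variable {A} in
/-- The class of a labelled operation. -/
def Labelled.cls {V : Type} (s : A.Labelled V) : A.LabelledClass V :=
  Quotient.mk _ s

variable {A} in
theorem Labelled.cls_eq {V : Type} {s t : A.Labelled V} (σ : t.ι ≃ s.ι)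
    (h : ∀ k, s.label (σ k) = t.label k) (h' : IsReindexing σ s.op t.op) : s.cls = t.cls :=
  Quotient.sound (s := Labelled.setoid) ⟨σ, h, h'⟩

/-- The laws for operations hold only up to bijections of places. These bijections preserve labels,
so the laws become equalities of classes, and finite products over unordered sets are available. -/
instance (V : Type) : CommMonoid (A.LabelledClass V) where
  mul := Quotient.map₂ Labelled.mul fun s s' ⟨σ, h, h'⟩ t t' ⟨τ, k, k'⟩ =>
    ⟨Equiv.sumCongr σ τ, fun p => by
      rcases p with x | x
      · exact h x
      · exact k x, isReindexing_comp₂_congr A.mul h' k'⟩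
  one := Labelled.one.cls
  mul_assoc a b c := by
    induction a, b, c using Quotient.inductionOn₃ with | _ a b c => ?_
    refine Eq.symm (Labelled.cls_eq (s := a.mul (b.mul c)) (t := (a.mul b).mul c)
      (Equiv.sumAssoc _ _ _) ?_
      (A.isReindexing_mul_assoc a.op b.op c.op))
    rintro ((x | x) | x) <;> rfl
  one_mul a := by
    induction a using Quotient.inductionOn with | _ a => ?_
    refine Eq.symm (Labelled.cls_eq (s := a) (t := Labelled.one.mul a) (Equiv.emptySum Empty _) ?_
      (A.isReindexing_unit_mul a.op))
    rintro (x | x)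
    · exact x.elim
    · rfl
  mul_one a := by
    induction a using Quotient.inductionOn with | _ a => ?_
    refine Eq.symm (Labelled.cls_eq (s := a) (t := a.mul Labelled.one) (Equiv.sumEmpty _ Empty) ?_
      (((A.isReindexing_unit_mul a.op).trans (A.isReindexing_mul_comm A.unit a.op)).congr ?_))
    · rintro (x | x)
      · rfl
      · exact x.elim
    · rintro (x | x)
      · rfl
      · exact x.elim
  mul_comm a b := by
    induction a, b using Quotient.inductionOn₂ with | _ a b => ?_
    refine Labelled.cls_eq (s := a.mul b) (t := b.mul a) (Equiv.sumComm _ _) ?_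
      (A.isReindexing_mul_comm a.op b.op)
    rintro (x | x) <;> rfl

variable {A} in
/-- An operation on a commutative monoid is an iterated multiplication if substitution in it
computes products. -/
def IsFold {ι : Type} [Finite ι] (f : M.Hom (fun _ : ι => A.X) A.X) : Prop :=
  ∀ (V : Type) (s : ι → A.Labelled V), (Labelled.subst f s).cls = ∏ᶠ i, (s i).cls

theorem isFold_id : IsFold (M.id A.X) := by
  intro V s
  rw [finprod_unique]
  exact (Labelled.cls_eq (s := s ()) (t := Labelled.subst (M.id A.X) s)
    (unitSigma (s ()).ι) (fun _ => rfl)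
    (.id_comp (s ()).op)).symm

theorem isFold_unit : IsFold A.unit := by
  intro V s
  rw [finprod_of_isEmpty]
  exact (Labelled.cls_eq (s := Labelled.one) (t := Labelled.subst A.unit s)
    (Equiv.equivOfIsEmpty (Σ e, (s e).ι) Empty) (fun k => k.1.elim)
    (isReindexing_comp_of_isEmpty A.unit fun e => (s e).op)).symm

theorem isFold_mul : IsFold A.mul := by
  intro V s
  -- `Fintype.prod_bool` puts the factor at `true` first, whereas `comp₂` puts `false` first.
  rw [finprod_eq_prod_of_fintype, Fintype.prod_bool, _root_.mul_comm]
  refine Labelled.cls_eq (s := Labelled.subst A.mul s) (t := (s false).mul (s true))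
    (sumSigmaBool fun b => (s b).ι) ?_
    (isReindexing_comp₂ A.mul fun b => (s b).op)
  rintro (x | x) <;> rfl

variable {A}

/-- Substitution is associative, and a product over a disjoint union is a product of products. -/
theorem IsFold.comp {ι : Type} [Finite ι] {κ : ι → Type} [∀ i, Finite (κ i)]
    {f : M.Hom (fun _ : ι => A.X) A.X} {g : ∀ i, M.Hom (fun _ : κ i => A.X) A.X}
    (hf : IsFold f) (hg : ∀ i, IsFold (g i)) :
    IsFold (M.comp (X := fun i (_ : κ i) => A.X) f g) := by
  intro V s
  have h := hf V fun i => Labelled.subst (g i) fun k => s ⟨i, k⟩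
  have h' : (Labelled.subst f fun i => Labelled.subst (g i) fun k => s ⟨i, k⟩).cls =
      (Labelled.subst (M.comp (X := fun i (_ : κ i) => A.X) f g) s).cls :=
    Labelled.cls_eq (Equiv.sigmaAssoc fun i k => (s ⟨i, k⟩).ι) (fun _ => rfl)
      (.assoc f g fun i k => (s ⟨i, k⟩).op)
  refine h'.symm.trans (h.trans ((finprod_congr fun i => hg i V fun k => s ⟨i, k⟩).trans ?_))
  have := Fintype.ofFinite ι
  have := fun i => Fintype.ofFinite (κ i)
  simp only [finprod_eq_prod_of_fintype]
  exact (Fintype.prod_sigma fun p => (s p).cls).symm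

theorem IsFold.reindex {ι κ : Type} [Finite ι] [Finite κ] {f : M.Hom (fun _ : ι => A.X) A.X}
    (hf : IsFold f) (σ : κ ≃ ι) : IsFold (M.reindex σ f) := by
  intro V s
  obtain ⟨t, rfl⟩ : ∃ t : ι → A.Labelled V, (fun k => t (σ k)) = s :=
    ⟨fun i => s (σ.symm i), by simp⟩
  have h : (Labelled.subst f t).cls = (Labelled.subst (M.reindex σ f) fun k => t (σ k)).cls :=
    Labelled.cls_eq (Equiv.sigmaCongrLeft (β := fun i => (t i).ι) σ) (fun _ => rfl)
      ((IsReindexing.reindex σ f).comp_left fun i => (t i).op)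
  exact h.symm.trans ((hf V t).trans (finprod_comp_equiv σ).symm)

/-- Label each place by itself: both classes equal the product of the variables, and a
label-preserving bijection between them must be the identity. -/
theorem IsFold.unique {ι : Type} [Finite ι] {f g : M.Hom (fun _ : ι => A.X) A.X}
    (hf : IsFold f) (hg : IsFold g) : f = g := by
  obtain ⟨σ, h, h'⟩ := Quotient.exact (s := Labelled.setoid)
    ((hf ι Labelled.var).trans (hg ι Labelled.var).symm)
  have e := ((IsReindexing.comp_id f).trans h').trans (IsReindexing.comp_id g).symm
  exact e.eq fun i => h ⟨i, ()⟩

variable (A)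

theorem exists_isFold (ι : Type) [Finite ι] : ∃ f : M.Hom (fun _ : ι => A.X) A.X, IsFold f := by
  refine finite_induction (P := fun ι _ => ∃ f : M.Hom (fun _ : ι => A.X) A.X, IsFold f)
    ⟨_, A.isFold_unit⟩ ⟨_, A.isFold_id⟩ ⟨_, A.isFold_mul⟩ ?_ ?_ ι
  · intro ι _ κ _ ⟨f, hf⟩ h
    choose g hg using h
    exact ⟨_, hf.comp hg⟩
  · intro ι κ _ _ σ ⟨f, hf⟩
    exact ⟨_, hf.reindex σ⟩

/-! ### Functors from `1_▸` given by iterated multiplication -/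

/-- The iterated multiplication `X, …, X → X` of a commutative monoid. -/
noncomputable def fold (ι : Type) [Finite ι] : M.Hom (fun _ : ι => A.X) A.X :=
  (A.exists_isFold ι).choose

theorem isFold_fold (ι : Type) [Finite ι] : IsFold (A.fold ι) := (A.exists_isFold ι).choose_spec

/-- The functor `1_▸ → M` corresponding to a commutative monoid in `M`. -/
noncomputable def toFunctor : MFunctor one M where
  obj _ := A.X
  map {ι _ _ _} _ := A.fold ι
  map_id _ := (A.isFold_fold _).unique A.isFold_id
  map_comp _ _ := (A.isFold_fold _).unique ((A.isFold_fold _).comp fun _ => A.isFold_fold _)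
  map_reindex σ _ := (A.isFold_fold _).unique ((A.isFold_fold _).reindex σ)

/-- The commutative monoid in `1_▸`. -/
def terminal : CMonoid one.{w} where
  X := star
  mul := one.fold star Bool
  unit := one.fold star Empty
  mul_assoc := Subsingleton.elim _ _
  unit_mul := Subsingleton.elim _ _
  mul_unit := Subsingleton.elim _ _
  mul_comm := Subsingleton.elim _ _

variable {A} in
theorem ext {B : CMonoid M} (h : A.X = B.X) (h₁ : HEq A.mul B.mul) (h₂ : HEq A.unit B.unit) :
    A = B := by
  obtain ⟨X, mul, unit, _, _, _, _⟩ := A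
  obtain ⟨Y, mul', unit', _, _, _, _⟩ := B
  obtain rfl : X = Y := h
  obtain rfl := eq_of_heq h₁
  obtain rfl := eq_of_heq h₂
  rfl

theorem toFunctor_map_terminal : terminal.map A.toFunctor = A := by
  exact CMonoid.ext rfl (heq_of_eq ((A.isFold_fold _).unique A.isFold_mul))
    (heq_of_eq ((A.isFold_fold _).unique A.isFold_unit))

/-- The images under `F` of the folds of `1_▸` are iterated multiplications, by induction on the
arity; uniqueness identifies them with the chosen ones. -/
theorem map_terminal_toFunctor (F : MFunctor one M) : (terminal.map F).toFunctor = F := by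
  refine MFunctor.ext rfl (heq_of_eq ?_)
  funext ι _ a b f
  suffices h : IsFold (A := terminal.map F) (F.map (one.fold star ι)) from
    ((isFold_fold _ ι).unique h).trans (congrArg F.map (Subsingleton.elim _ _))
  refine finite_induction
    (P := fun ι _ => IsFold (A := terminal.map F) (F.map (one.fold star ι)))
    (isFold_unit _) ?_ (isFold_mul _) ?_ ?_ ι
  · exact (F.map_id star) ▸ isFold_id (terminal.map F)
  · intro ι _ κ _ hf hg
    have h := F.map_comp (one.fold star ι) fun i => one.fold star (κ i)
    exact h ▸ hf.comp hg
  · intro ι κ _ _ σ hf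
    have h := F.map_reindex σ (one.fold star ι)
    exact h ▸ hf.reindex σ

variable {A} {B : CMonoid M}

/-- Compatibility with the unit and the multiplication propagates to all arities, which makes a
morphism of monoids multinatural. -/
theorem Morphism.comp_fold (h : Morphism A B) (ι : Type) [Finite ι] :
    M.comp h.hom (fun _ => A.fold ι) =
      M.reindex (sigmaSwap Unit ι) (M.comp (B.fold ι) fun _ => h.hom) := by
  refine finite_induction (P := fun ι _ => M.comp h.hom (fun _ => A.fold ι) =
      M.reindex (sigmaSwap Unit ι) (M.comp (B.fold ι) fun _ => h.hom)) ?_ ?_ ?_ ?_ ?_ ι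
  · rw [(A.isFold_fold _).unique A.isFold_unit, (B.isFold_fold _).unique B.isFold_unit]
    exact h.map_unit
  · rw [(A.isFold_fold _).unique A.isFold_id, (B.isFold_fold _).unique B.isFold_id]
    exact ((IsReindexing.comp_id h.hom).symm.trans (IsReindexing.id_comp h.hom)).symm.eq_reindex
      fun _ => rfl
  · rw [(A.isFold_fold _).unique A.isFold_mul, (B.isFold_fold _).unique B.isFold_mul]
    exact h.map_mul
  · intro ι _ κ _ hf hg
    rw [(A.isFold_fold _).unique ((A.isFold_fold ι).comp fun i => A.isFold_fold (κ i)),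
      (B.isFold_fold _).unique ((B.isFold_fold ι).comp fun i => B.isFold_fold (κ i))]
    have h₁ := IsReindexing.assoc h.hom (fun _ => A.fold ι) fun _ i => A.fold (κ i)
    have h₂ := (IsReindexing.of_eq (σ := sigmaSwap Unit ι)
      (f := M.comp (B.fold ι) fun _ => h.hom) hf).comp_left fun p : Σ _ : ι, Unit => A.fold (κ p.1)
    have h₃ := IsReindexing.assoc (B.fold ι) (fun _ => h.hom) fun i _ => A.fold (κ i)
    have h₄ := IsReindexing.comp_right (B.fold ι) fun i =>
      IsReindexing.of_eq (σ := sigmaSwap Unit (κ i)) (f := M.comp (B.fold (κ i)) fun _ => h.hom) (hg i)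
    have h₅ := IsReindexing.assoc (B.fold ι) (fun i => B.fold (κ i)) fun _ _ => h.hom
    exact ((h₅.symm.trans h₄).trans ((h₃.trans h₂).trans h₁.symm)).eq_reindex fun _ => rfl
  · intro ι κ _ _ σ hf
    rw [(A.isFold_fold _).unique ((A.isFold_fold ι).reindex σ),
      (B.isFold_fold _).unique ((B.isFold_fold ι).reindex σ)]
    have h₁ := IsReindexing.comp_right h.hom fun _ => IsReindexing.reindex σ (A.fold ι)
    have h₂ := (IsReindexing.reindex σ (B.fold ι)).comp_left fun _ => h.hom
    have h₃ := IsReindexing.of_eq (σ := sigmaSwap Unit ι)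
      (f := M.comp (B.fold ι) fun _ => h.hom) hf
    -- The composite contains the inverse of `Equiv.sigmaCongrLeft`, so it is compared after
    -- applying that bijection.
    exact ((h₂.symm.trans h₃).trans h₁).eq_reindex fun _ =>
      (Equiv.symm_apply_eq (Equiv.sigmaCongrLeft (β := fun _ : ι => Unit) σ)).2 rfl

end CMonoid

/-! ### Functors `1_▸ → M` and commutative monoids in `M` -/

section

variable (M : SymMulticat.{u + 1})

/-- A functor `1_▸ → M` gives a commutative monoid in `M`. -/
def toCMonoid : (ihom one M).Und ⥤ CMonoid M where
  obj F := CMonoid.terminal.map F.obj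
  map α := ⟨α.1 star, IsMultinatural.comp_map α.2 (one.fold star Bool),
    IsMultinatural.comp_map α.2 (one.fold star Empty)⟩
  map_id _ := rfl
  map_comp _ _ := rfl

/-- A commutative monoid in `M` gives a functor `1_▸ → M`. -/
noncomputable def ofCMonoid : CMonoid M ⥤ (ihom one M).Und where
  obj A := ⟨A.toFunctor⟩
  map {_ B} h := ⟨fun _ => h.hom, fun {κ} _ _ _ _ =>
    (IsReindexing.of_eq (σ := sigmaSwap Unit κ)
      (f := M.comp (B.fold κ) fun _ => h.hom) (h.comp_fold κ)).symm.eq_reindex fun _ => rfl⟩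
  map_id _ := rfl
  map_comp _ _ := rfl

variable {M}

/-- The round trips are identities on objects only propositionally, so arrows are compared across
equal endpoints. -/
theorem ihom_one_hom_heq {F F' G G' : (ihom one M).Und} (hF : F = F') (hG : G = G')
    {α : F ⟶ G} {β : F' ⟶ G'} (h : HEq (α.1 star) (β.1 star)) : HEq α β := by
  subst hF hG
  exact heq_of_eq (Subtype.ext (funext fun _ => eq_of_heq h))

theorem CMonoid.hom_heq {A A' B B' : CMonoid M} (hA : A = A') (hB : B = B')
    {f : A ⟶ B} {g : A' ⟶ B'} (h : HEq f.hom g.hom) : HEq f g := by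
  subst hA hB
  exact heq_of_eq (CMonoid.Morphism.ext (eq_of_heq h))

variable (M)

theorem toCMonoid_ofCMonoid : toCMonoid M ⋙ ofCMonoid M = 𝟭 _ := by
  have h (F : (ihom one M).Und) : (toCMonoid M ⋙ ofCMonoid M).obj F = F :=
    congrArg (Und.of (M := ihom one M)) (CMonoid.map_terminal_toFunctor (M := M) F.obj)
  exact Functor.hext h fun F G α => ihom_one_hom_heq (h F) (h G) HEq.rfl

theorem ofCMonoid_toCMonoid : ofCMonoid M ⋙ toCMonoid M = 𝟭 _ := by
  have h (A : CMonoid M) : (ofCMonoid M ⋙ toCMonoid M).obj A = A := A.toFunctor_map_terminal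
  exact Functor.hext h fun A B f => CMonoid.hom_heq (h A) (h B) HEq.rfl

/-- `[1_▸, -]_-` is isomorphic to `cMon(-)`. -/
noncomputable def ihomUndIso : ihomFunctor.{u} one ⋙ und ≅ cMonFunctor :=
  NatIso.ofComponents
    (fun M =>
      { hom := (toCMonoid M).toCatHom
        inv := (ofCMonoid M).toCatHom
        hom_inv_id := congrArg Functor.toCatHom (toCMonoid_ofCMonoid M)
        inv_hom_id := congrArg Functor.toCatHom (ofCMonoid_toCMonoid M) })
    -- Naturality in `M` holds strictly: the monoid of a composite functor is the image of the
    -- monoid.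
    fun _ => rfl

end

end SymMulticat

theorem mainTheorem2 :
    -- `1_▸ ⊗ -` is a reflection of `sMlt` in `Seq`, with unit the canonical `M → 1_▸ ⊗ M`
    (∃ (h : ∀ M : SymMulticat.{u + 1}, IsSequential ((tensorFunctor one).obj M))
      (adj : IsSequential.lift (tensorFunctor one) h ⊣ IsSequential.ι),
      ∀ M : SymMulticat.{u + 1}, adj.unit.app M = insertion M) ∧
    -- `[1_▸, -]` is a coreflection of `sMlt` in `Seq`, with counit the canonical `[1_▸, M] → M`
    (∃ (h : ∀ M : SymMulticat.{u + 1}, IsSequential ((ihomFunctor one).obj M))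
      (adj : IsSequential.ι ⊣ IsSequential.lift (ihomFunctor one) h),
      ∀ M : SymMulticat.{u + 1}, adj.counit.app M = evaluation M) ∧
    -- `(1_▸ ⊗ -)_- ⊣ (-)_▸ ⊣ [1_▸, -]_- ≅ cMon(-)`
    Nonempty (tensorFunctor.{u} one ⋙ und ⊣ seqFunctor) ∧
    Nonempty (seqFunctor ⊣ ihomFunctor.{u} one ⋙ und) ∧
    Nonempty (ihomFunctor.{u} one ⋙ und ≅ cMonFunctor) ∧
    Nonempty (seqFunctor.{u + 1} ⊣ cMonFunctor) := by
  exact ⟨⟨isSequential_tensor_one, tensorAdjunction, tensorAdjunction_unit_app⟩,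
    ⟨isSequential_ihom_one, ihomAdjunction, ihomAdjunction_counit_app⟩,
    ⟨tensorUndAdjunction⟩, ⟨seqAdjunction⟩, ⟨ihomUndIso⟩,
    ⟨seqAdjunction.ofNatIsoRight ihomUndIso⟩⟩
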